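/- Let $k$ be an arbitrary field. For a finite set $A$ of positive integers, let $\langle A\rangle\subseteq\mathbb N$ be the semigroup (containing $0$) generated by $A$; it is called numerical if $\gcd(A)=1$, and $A$ is its minimal generating set if no proper subset of $A$ generates $\langle A\rangle$. Let $R_A=k[x_a : a\in A]$, graded by giving $x_a$ weight $a$, let $\varphi_A:R_A\to k[t]$ be the $k$-algebra homomorphism with $\varphi_A(x_a)=t^a$, let $I_A=\ker\varphi_A$, and let $k[A]\cong R_A/I_A$ be the semigroup ring, a graded $R_A$-module. Let $\beta_{i,j}(A)$ be the number of basis elements of degree $j$ in the $i$-th step of a minimal graded free resolution of $k[A]$ over $R_A$ (with $k[A]$ resolved from step $0$), and let $$\mathrm{reg}(A)=\max\{\,j-i \;:\; i,j\ge 0,\ \beta_{i,j}(A)\neq 0\,\}$$ be the (weighted) Castelnuovo–Mumford regularity. Let $A$, $B$, $C$ be the minimal generating sets of numerical semigroups $\langle A\rangle$, $\langle B\rangle$, $\langle C\rangle$, with $\#A=p$ and $\#B=q$, and suppose that $\langle C\rangle$ is the gluing of $\langle A\rangle$ and $\langle B\rangle$: $C=k_1A\sqcup k_2B$ (a disjoint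 union), where $k_1,k_2$ are relatively prime positive integers with $k_1\in\langle B\rangle\setminus B$ and $k_2\in\langle A\rangle\setminus A$. Then the regularities of $A$, $B$ and $C$ exist (minimal graded free resolutions exist, and the maxima are attained and do not depend on the resolution), and $$\mathrm{reg}(C)=k_1\,\mathrm{reg}(A)+k_2\,\mathrm{reg}(B)+(p-1)(k_1-1)+(q-1)(k_2-1)+k_1k_2-1 .$$ -/

import Mathlib

namespace NumSemigroup

open MvPolynomial

/-- The semigroup `⟨A⟩ ⊆ ℕ` (containing `0`) generated by `A`. -/
def gen (A : Finset ℕ) : AddSubmonoid ℕ := AddSubmonoid.closure (A : Set ℕ)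

/-- `A` is a finite set of positive integers which minimally generates `⟨A⟩` (no proper subset
generates the same semigroup), and `⟨A⟩` is a numerical semigroup (the gcd of `A` is `1`).
The gcd of the empty set is `0`, so `A` is nonempty. -/
structure IsMinGenNumerical (A : Finset ℕ) : Prop where
  pos : ∀ a ∈ A, 0 < a
  gcd_eq_one : A.gcd id = 1
  minimal : ∀ A' : Finset ℕ, A' ⊂ A → gen A' ≠ gen A

/-- The numerical semigroup `⟨C⟩` is the gluing of the numerical semigroups `⟨A⟩` and `⟨B⟩`, with
`C = k₁ A ⊔ k₂ B`. -/
structure IsGluing (C A B : Finset ℕ) (k₁ k₂ : ℕ) : Prop where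
  left : IsMinGenNumerical A
  right : IsMinGenNumerical B
  glued : IsMinGenNumerical C
  pos₁ : 0 < k₁
  pos₂ : 0 < k₂
  coprime : Nat.Coprime k₁ k₂
  mem₁ : k₁ ∈ gen B
  notMem₁ : k₁ ∉ B
  mem₂ : k₂ ∈ gen A
  notMem₂ : k₂ ∉ A
  union : C = A.image (fun a => k₁ * a) ∪ B.image (fun b => k₂ * b)
  disjoint : Disjoint (A.image (fun a => k₁ * a)) (B.image (fun b => k₂ * b))

section Resolution

/-- A minimal graded free resolution
`⋯ → F₂ → F₁ → F₀ → M → 0` by finitely generated free modules over the polynomial ring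
`R = k[x_s : s ∈ σ]`, where `x_s` has weight `w s` and `M` is a graded `R`-module with graded
components `𝓜 n`. The module `F i` is free on a finite set `ι i` of homogeneous basis elements,
the basis element `a` having degree `deg i a`, i.e. `F i = ⨁ₐ R(-deg i a)`. -/
structure MinimalGradedFreeResolution {k σ : Type*} [Field k] (w : σ → ℕ)
    (M : Type*) [AddCommGroup M] [Module k M] [Module (MvPolynomial σ k) M]
    (𝓜 : ℕ → Submodule k M) where
  /-- The index set of the homogeneous basis of `F i`. -/
  ι : ℕ → Type
  finite : ∀ i, Finite (ι i)
  /-- The degree of a basis element. -/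
  deg : ∀ i, ι i → ℕ
  /-- The differential `F (i + 1) → F i`. -/
  d : ∀ i, (ι (i + 1) →₀ MvPolynomial σ k) →ₗ[MvPolynomial σ k] (ι i →₀ MvPolynomial σ k)
  /-- The augmentation `F 0 → M`. -/
  ε : (ι 0 →₀ MvPolynomial σ k) →ₗ[MvPolynomial σ k] M
  /-- The augmentation preserves degrees. -/
  ε_homogeneous : ∀ a, ε (Finsupp.single a 1) ∈ 𝓜 (deg 0 a)
  /-- The differentials preserve degrees: the coefficient of `a` in the image of `b` is
  homogeneous of degree `deg b - deg a`. -/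
  d_homogeneous : ∀ i (b : ι (i + 1)) (a : ι i) (m : σ →₀ ℕ),
    coeff m (d i (Finsupp.single b 1) a) ≠ 0 → Finsupp.weight w m + deg i a = deg (i + 1) b
  ε_surjective : Function.Surjective ε
  exact_zero : LinearMap.range (d 0) = LinearMap.ker ε
  exact_succ : ∀ i, LinearMap.range (d (i + 1)) = LinearMap.ker (d i)
  /-- Minimality: the image of `F (i + 1)` lies in `(x_s : s ∈ σ) F i`. -/
  minimal : ∀ i, LinearMap.range (d i) ≤
    Ideal.span (Set.range (X : σ → MvPolynomial σ k)) •
      (⊤ : Submodule (MvPolynomial σ k) (ι i →₀ MvPolynomial σ k))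

variable {k σ : Type*} [Field k] {w : σ → ℕ}
  {M : Type*} [AddCommGroup M] [Module k M] [Module (MvPolynomial σ k) M]
  {𝓜 : ℕ → Submodule k M}

/-- The graded Betti number `β_{i,j}` read off from a minimal graded free resolution: the number
of basis elements of degree `j` in the `i`-th step. -/
noncomputable def MinimalGradedFreeResolution.betti
    (F : MinimalGradedFreeResolution w M 𝓜) (i j : ℕ) : ℕ :=
  Nat.card {a : F.ι i // F.deg i a = j}

/-- `r` is the (weighted) Castelnuovo-Mumford regularity
`reg M = max {j - i | β_{i,j}(M) ≠ 0}`. This asserts that `M` has a minimal graded free resolution,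
and that for the Betti numbers of every such resolution the maximum exists and is equal to `r`. -/
def IsRegularity (w : σ → ℕ) (M : Type*) [AddCommGroup M] [Module k M]
    [Module (MvPolynomial σ k) M] (𝓜 : ℕ → Submodule k M) (r : ℤ) : Prop :=
  Nonempty (MinimalGradedFreeResolution w M 𝓜) ∧
    ∀ F : MinimalGradedFreeResolution w M 𝓜,
      IsGreatest {s : ℤ | ∃ i j : ℕ, F.betti i j ≠ 0 ∧ s = (j : ℤ) - (i : ℤ)} r

end Resolution

section SemigroupRing

variable (k : Type*) [Field k] (A : Finset ℕ)

/-- The algebra homomorphism `φ_A : k[x_a : a ∈ A] → k[t]`, `x_a ↦ t ^ a`. -/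
noncomputable def phi : MvPolynomial A k →ₐ[k] Polynomial k :=
  aeval (fun a : A => (Polynomial.X : Polynomial k) ^ (a : ℕ))

/-- The ideal `I_A = ker φ_A`. -/
noncomputable def definingIdeal : Ideal (MvPolynomial A k) := RingHom.ker (phi k A)

/-- The semigroup ring `k[A] ≅ k[x_a : a ∈ A] / I_A`. -/
abbrev SemigroupRing : Type _ := MvPolynomial A k ⧸ definingIdeal k A

/-- The weight of the variable `x_a` is `a`. -/
def weights : A → ℕ := fun a => (a : ℕ)

/-- The component of degree `n` of `k[A]`: the classes of the weighted homogeneous polynomials of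
degree `n`. -/
noncomputable def component (n : ℕ) : Submodule k (SemigroupRing k A) :=
  (weightedHomogeneousSubmodule k (weights A) n).map
    (Ideal.Quotient.mkₐ k (definingIdeal k A)).toLinearMap

/-- `reg(A) = r`: the weighted regularity of `k[A]`, as a graded module over `k[x_a : a ∈ A]` with
`x_a` of weight `a`, is `r`. -/
def HasReg (r : ℤ) : Prop :=
  IsRegularity (weights A) (SemigroupRing k A) (component k A) r

end SemigroupRing

end NumSemigroup

/-! The regularity of a numerical semigroup ring is determined by the Frobenius number `f` of `⟨A⟩`:
it equals `f + ∑ a - (#A - 1)` (`IsFrobenius.hasReg`). For a gluing, the Frobenius number is `k₁ f₁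
+ k₂ f₂ + k₁ k₂` (`IsFrobenius.gluing`), cardinalities add, and the sum of the generators is `k₁ ∑ a
+ k₂ ∑ b`. Substituting gives the formula.

For the regularity, Betti numbers are read off from Koszul homology: `β_{i,j} ≠ 0` exactly when the
Koszul complex of `k[A]` has homology in bidegree `(i, j)` (`betti_ne_zero_iff_not_acyclic`). This
follows by dimension shifting along the syzygies, since the Koszul complex of a free module is exact
up to constant terms (`exists_koszulD_eq`).

Inside Laurent series, the strand of internal degree `j` is the augmented chain complex of the full
simplex on `A`, and `k[A]` cuts out the faces `T` with `j - ∑ T ∈ ⟨A⟩`. If `j - i` exceeds the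
claimed value, every face with `i + 1` vertices is present, so a cone bounds each `i`-cycle
(`IsFrobenius.acyclic`). For `j = f + ∑ a`, all facets of the simplex are present but the top face
is not, as it would need `f ∈ ⟨A⟩`; the boundary of the simplex then represents a nonzero class for
`i = #A - 1` (`IsFrobenius.not_acyclic`). -/

set_option linter.unusedSectionVars false

namespace NumSemigroup

open MvPolynomial

set_option linter.unusedSectionVars false

/-! ### Koszul complexes of graded commuting operators, and dimension shifting -/

section Koszul

variable {σ : Type*} [Fintype σ] [LinearOrder σ]

/-- The sign with which `insert s T` has `T` in its boundary. -/
def koszulSign (s : σ) (T : Finset σ) : ℤ := (-1) ^ (T.filter (· < s)).card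

lemma koszulSign_mul_self (s : σ) (T : Finset σ) : koszulSign s T * koszulSign s T = 1 := by
  simp [koszulSign, ← mul_pow]

lemma koszulSign_insert {s v : σ} {T : Finset σ} (hv : v ∉ T) :
    koszulSign s (insert v T) = (if v < s then -1 else 1) * koszulSign s T := by
  unfold koszulSign
  rw [Finset.filter_insert]
  split_ifs with h
  · rw [Finset.card_insert_of_notMem (by simp [hv]), pow_succ]; ring
  · ring

lemma koszulSign_swap {s v : σ} {T : Finset σ} (hsv : s ≠ v) (hs : s ∉ T) (hv : v ∉ T) :
    koszulSign s (insert v T) * koszulSign v (insert s T) =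
      -(koszulSign v T * koszulSign s T) := by
  rw [koszulSign_insert hv, koszulSign_insert hs]
  rcases lt_or_gt_of_ne hsv with h | h
  · simp [h, h.not_gt, mul_comm]
  · simp [h, h.not_gt, mul_comm]

lemma koszulSign_swap' {s v : σ} {T : Finset σ} (hsv : s ≠ v) (hs : s ∉ T) (hv : v ∉ T) :
    koszulSign s T * koszulSign v (insert s T) =
      -(koszulSign v T * koszulSign s (insert v T)) := by
  rw [koszulSign_insert hv, koszulSign_insert hs]
  rcases lt_or_gt_of_ne hsv with h | h
  · simp [h, h.not_gt, mul_comm]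
  · simp [h, h.not_gt, mul_comm]

variable {N N' : Type*} [AddCommGroup N] [AddCommGroup N']

/-- The differential of the Koszul complex of the operators `x s` on `N`; a chain is a function
on the subsets of `σ`. -/
def koszulD (x : σ → N →+ N) : (Finset σ → N) →+ (Finset σ → N) where
  toFun f T := ∑ s ∈ Tᶜ, koszulSign s T • x s (f (insert s T))
  map_zero' := by ext; simp
  map_add' f g := by ext; simp [Finset.sum_add_distrib]

lemma koszulD_apply (x : σ → N →+ N) (f : Finset σ → N) (T : Finset σ) :
    koszulD x f T = ∑ s ∈ Tᶜ, koszulSign s T • x s (f (insert s T)) := rfl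

lemma koszulD_koszulD (x : σ → N →+ N) (hx : ∀ s t y, x s (x t y) = x t (x s y))
    (f : Finset σ → N) : koszulD x (koszulD x f) = 0 := by
  ext T
  simp only [koszulD_apply, map_sum, map_zsmul, Finset.smul_sum, smul_smul, Pi.zero_apply]
  rw [Finset.sum_sigma']
  -- Removing `s` and `v` in the two possible orders gives equal terms with opposite signs.
  refine Finset.sum_involution (fun p _ => ⟨p.2, p.1⟩) ?_ ?_ ?_ ?_
  · rintro ⟨s, v⟩ h
    simp only [Finset.mem_sigma, Finset.mem_compl, Finset.mem_insert, not_or] at h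
    obtain ⟨hs, hvs, hv⟩ := h
    dsimp only
    rw [koszulSign_swap' (Ne.symm hvs) hs hv, hx s v, Finset.insert_comm s v, neg_smul,
      neg_add_cancel]
  · rintro ⟨s, v⟩ h _ he
    simp only [Finset.mem_sigma, Finset.mem_compl, Finset.mem_insert, not_or] at h
    simp only [Sigma.mk.injEq, heq_eq_eq] at he
    exact h.2.1 he.1
  · rintro ⟨s, v⟩ h
    simp only [Finset.mem_sigma, Finset.mem_compl, Finset.mem_insert, not_or] at h ⊢
    exact ⟨h.2.2, Ne.symm h.2.1, h.1⟩
  · rintro ⟨s, v⟩ h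
    rfl

/-- The cone with apex `v`, a contraction of the chain complex of the full simplex on `σ`. -/
def cone (v : σ) (c : Finset σ → N) (T : Finset σ) : N :=
  if v ∈ T then koszulSign v (T.erase v) • c (T.erase v) else 0

/-- Chains live on all subsets, the empty one included, so this is the augmented complex of the
simplex and the homotopy identity has no exceptional degree. -/
lemma koszulD_cone (v : σ) (c : Finset σ → N) :
    koszulD (fun _ => AddMonoidHom.id N) (cone v c) +
      cone v (koszulD (fun _ => AddMonoidHom.id N) c) = c := by
  ext T
  simp only [Pi.add_apply, koszulD_apply, AddMonoidHom.id_apply]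
  by_cases hv : v ∈ T
  · obtain ⟨U, hvU, rfl⟩ : ∃ U, v ∉ U ∧ insert v U = T :=
      ⟨T.erase v, Finset.notMem_erase v T, Finset.insert_erase hv⟩
    have hU : Uᶜ = insert v (insert v U)ᶜ := by
      ext a; by_cases h : a = v <;> simp [h, hvU]
    have hn : v ∉ (insert v U)ᶜ := by simp
    simp only [cone, Finset.mem_insert_self, if_true, Finset.erase_insert hvU, koszulD_apply,
      AddMonoidHom.id_apply]
    rw [hU, Finset.sum_insert hn, smul_add, smul_smul, koszulSign_mul_self, one_smul,
      add_left_comm, add_eq_left, Finset.smul_sum, ← Finset.sum_add_distrib]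
    refine Finset.sum_eq_zero fun s hs => ?_
    simp only [Finset.mem_compl, Finset.mem_insert, not_or] at hs
    have he : (insert s (insert v U)).erase v = insert s U := by
      rw [Finset.insert_comm, Finset.erase_insert]
      simp [Ne.symm hs.1, hvU]
    rw [if_pos (by simp), he, smul_smul, smul_smul, koszulSign_swap hs.1 hs.2 hvU, neg_smul,
      neg_add_cancel]
  · rw [Finset.sum_eq_single v]
    · simp [cone, hv, smul_smul, koszulSign_mul_self]
    · intro s _ hs
      simp [cone, hv, Ne.symm hs]
    · simp [hv]

/-- A `ℤ`-grading on `N`, given by the projections to the graded components, together with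
commuting operators `x s` of degree `w s`. -/
structure GradedOperators (w : σ → ℕ) (N : Type*) [AddCommGroup N] where
  x : σ → N →+ N
  comm : ∀ s t y, x s (x t y) = x t (x s y)
  comp : ℤ → N →+ N
  comp_comp : ∀ z y, comp z (comp z y) = comp z y
  comp_x : ∀ z s y, comp (z + w s) (x s y) = x s (comp z y)

namespace GradedOperators

variable {w : σ → ℕ} (G : GradedOperators w N) (G' : GradedOperators w N')

/-- The projection of a Koszul chain to homological degree `i` and internal degree `j`. -/
def proj (i : ℕ) (j : ℤ) (f : Finset σ → N) (T : Finset σ) : N :=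
  if T.card = i then G.comp (j - ∑ s ∈ T, (w s : ℤ)) (f T) else 0

/-- A Koszul chain of homological degree `i` and internal degree `j`. -/
def IsHomogeneous (i : ℕ) (j : ℤ) (f : Finset σ → N) : Prop := G.proj i j f = f

lemma isHomogeneous_proj (i : ℕ) (j : ℤ) (f : Finset σ → N) :
    G.IsHomogeneous i j (G.proj i j f) := by
  ext T
  simp only [proj]
  split_ifs <;> simp [G.comp_comp]

/-- Adding `s` to `T` lowers the coefficient degree by `w s`, and `x s` restores it. Hence any chain
bounding a homogeneous cycle can be replaced by its homogeneous part. -/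
lemma koszulD_proj (i : ℕ) (j : ℤ) (f : Finset σ → N) :
    koszulD G.x (G.proj (i + 1) j f) = G.proj i j (koszulD G.x f) := by
  ext T
  simp only [koszulD_apply, proj]
  split_ifs with h
  · rw [map_sum]
    refine Finset.sum_congr rfl fun s hs => ?_
    rw [Finset.mem_compl] at hs
    rw [if_pos (by rw [Finset.card_insert_of_notMem hs, h]), Finset.sum_insert hs, map_zsmul,
      ← G.comp_x]
    congr 3
    ring
  · refine Finset.sum_eq_zero fun s hs => ?_
    rw [Finset.mem_compl] at hs
    rw [if_neg (by rw [Finset.card_insert_of_notMem hs]; omega), map_zero, smul_zero]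

lemma IsHomogeneous.koszulD {i : ℕ} {j : ℤ} {f : Finset σ → N}
    (hf : G.IsHomogeneous (i + 1) j f) : G.IsHomogeneous i j (koszulD G.x f) := by
  rw [IsHomogeneous, ← koszulD_proj, hf]

variable {G G'} in
lemma IsHomogeneous.sub {i : ℕ} {j : ℤ} {f g : Finset σ → N} (hf : G.IsHomogeneous i j f)
    (hg : G.IsHomogeneous i j g) : G.IsHomogeneous i j (f - g) := by
  rw [IsHomogeneous] at hf hg ⊢
  nth_rw 2 [← hf, ← hg]
  ext T
  simp only [proj, Pi.sub_apply]
  split_ifs <;> simp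

/-- The Koszul homology of the subgroup `Z` vanishes in bidegree `(i, j)`. -/
def Acyclic (Z : AddSubgroup N) (i : ℕ) (j : ℤ) : Prop :=
  ∀ f : Finset σ → N, G.IsHomogeneous i j f → (∀ T, f T ∈ Z) → koszulD G.x f = 0 →
    ∃ g : Finset σ → N, G.IsHomogeneous (i + 1) j g ∧ (∀ T, g T ∈ Z) ∧ koszulD G.x g = f

/-- A homomorphism which commutes with the operators and preserves degrees. -/
structure IsHom (p : N →+ N') : Prop where
  map_x : ∀ s y, p (G.x s y) = G'.x s (p y)
  map_comp : ∀ z y, p (G.comp z y) = G'.comp z (p y)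

namespace IsHom

variable {G G'} {p : N →+ N'} (hp : IsHom G G' p)
include hp

lemma map_koszulD (f : Finset σ → N) :
    koszulD G'.x (fun T => p (f T)) = fun T => p (koszulD G.x f T) := by
  ext T
  simp [koszulD_apply, hp.map_x]

lemma isHomogeneous {i : ℕ} {j : ℤ} {f : Finset σ → N} (hf : G.IsHomogeneous i j f) :
    G'.IsHomogeneous i j (fun T => p (f T)) := by
  rw [IsHomogeneous] at hf ⊢
  nth_rw 2 [← hf]
  ext T
  simp only [proj]
  split_ifs <;> simp [hp.map_comp]

lemma exists_lift {i : ℕ} {j : ℤ} {f : Finset σ → N'} (hf : G'.IsHomogeneous i j f)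
    (hr : ∀ T, f T ∈ p.range) :
    ∃ g : Finset σ → N, G.IsHomogeneous i j g ∧ (fun T => p (g T)) = f := by
  choose g hg using hr
  refine ⟨G.proj i j g, G.isHomogeneous_proj i j g, ?_⟩
  rw [← hf]
  ext T
  simp only [proj]
  split_ifs <;> simp [hp.map_comp, hg]

/-- Dimension shifting along `0 → ker p → N → range p → 0`. -/
lemma acyclic_range_succ_iff {i : ℕ} {j : ℤ} (h₁ : G.Acyclic ⊤ (i + 1) j)
    (h₂ : ∀ f : Finset σ → N, G.IsHomogeneous i j f → (∀ T, f T ∈ p.ker) →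
      koszulD G.x f = 0 → ∃ g, G.IsHomogeneous (i + 1) j g ∧ koszulD G.x g = f) :
    G'.Acyclic p.range (i + 1) j ↔ G.Acyclic p.ker i j := by
  constructor
  · intro h f hf hk hc
    obtain ⟨g, hg, rfl⟩ := h₂ f hf hk hc
    obtain ⟨e, he, her, heg⟩ := h (fun T => p (g T)) (hp.isHomogeneous hg) (fun T => ⟨_, rfl⟩)
      (by rw [hp.map_koszulD]; ext T; exact hk T)
    obtain ⟨e', he', rfl⟩ := hp.exists_lift he her
    -- Subtracting a boundary keeps the boundary of `g` equal to `f` and moves `g` into the kernel.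
    refine ⟨g - koszulD G.x e', hg.sub (he'.koszulD), fun T => ?_, ?_⟩
    · rw [hp.map_koszulD] at heg
      rw [AddMonoidHom.mem_ker, Pi.sub_apply, map_sub, sub_eq_zero]
      exact (congrFun heg T).symm
    · rw [map_sub, koszulD_koszulD _ G.comm, sub_zero]
  · intro h f hf hr hc
    obtain ⟨f', hf', rfl⟩ := hp.exists_lift hf hr
    rw [hp.map_koszulD] at hc
    obtain ⟨g, hg, hgk, hgf⟩ := h (koszulD G.x f') hf'.koszulD (fun T => congrFun hc T)
      (koszulD_koszulD _ G.comm _)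
    obtain ⟨e, he, -, hef⟩ := h₁ (f' - g) (hf'.sub hg) (fun _ => trivial)
      (by rw [map_sub, hgf, sub_self])
    refine ⟨fun T => p (e T), hp.isHomogeneous he, fun T => ⟨_, rfl⟩, ?_⟩
    rw [hp.map_koszulD, hef]
    ext T
    rw [Pi.sub_apply, map_sub, (hgk T : p (g T) = 0), sub_zero]

end IsHom

end GradedOperators

end Koszul

/-! ### Graded free modules over the polynomial ring and their Koszul complexes -/

section FreeModule

variable {k σ ι κ : Type*} [Field k]

lemma exists_coeff_eq (f : (σ →₀ ℕ) → k) (hf : f.support.Finite) :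
    ∃ q : MvPolynomial σ k, ∀ m, coeff m q = f m := by
  classical
  refine ⟨∑ m ∈ hf.toFinset, monomial m (f m), fun m => ?_⟩
  rw [coeff_sum]
  simp only [coeff_monomial, Finset.sum_ite_eq', Set.Finite.mem_toFinset, Function.mem_support]
  split_ifs with h
  · rfl
  · exact (not_not.1 h).symm

lemma exists_polyComp (w : σ → ℕ) (z : ℤ) (q : MvPolynomial σ k) :
    ∃ r : MvPolynomial σ k, ∀ m,
      coeff m r = if (Finsupp.weight w m : ℤ) = z then coeff m q else 0 :=
  exists_coeff_eq _ (q.support.finite_toSet.subset fun m hm => by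
    simp only [Function.mem_support, ne_eq, ite_eq_right_iff, Classical.not_imp] at hm
    simpa using hm.2)

/-- The component of degree `z` of a polynomial, where `x_s` has weight `w s`. -/
noncomputable def polyComp (w : σ → ℕ) (z : ℤ) (q : MvPolynomial σ k) : MvPolynomial σ k :=
  (exists_polyComp w z q).choose

lemma coeff_polyComp (w : σ → ℕ) (z : ℤ) (q : MvPolynomial σ k) (m : σ →₀ ℕ) :
    coeff m (polyComp w z q) = if (Finsupp.weight w m : ℤ) = z then coeff m q else 0 :=
  (exists_polyComp w z q).choose_spec m

/-- The component of degree `z` of an element of `⨁ₐ R(-deg a)`. -/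
noncomputable def freeComp (w : σ → ℕ) (deg : ι → ℕ) (z : ℤ) :
    (ι →₀ MvPolynomial σ k) →ₗ[k] (ι →₀ MvPolynomial σ k) where
  toFun y := Finsupp.onFinset y.support (fun a => polyComp w (z - deg a) (y a)) (fun a ha => by
    rw [Finsupp.mem_support_iff]
    intro h
    refine ha (MvPolynomial.ext _ _ fun m => ?_)
    rw [h, coeff_polyComp]
    simp)
  map_add' y y' := by
    ext a m
    simp only [Finsupp.onFinset_apply, Finsupp.add_apply, coeff_add, coeff_polyComp]
    split_ifs <;> simp
  map_smul' c y := by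
    ext a m
    simp only [Finsupp.onFinset_apply, Finsupp.smul_apply, coeff_smul, coeff_polyComp,
      RingHom.id_apply]
    split_ifs <;> simp

lemma coeff_freeComp (w : σ → ℕ) (deg : ι → ℕ) (z : ℤ) (y : ι →₀ MvPolynomial σ k) (a : ι)
    (m : σ →₀ ℕ) : coeff m (freeComp w deg z y a) =
      if (Finsupp.weight w m : ℤ) + deg a = z then coeff m (y a) else 0 := by
  change coeff m (polyComp w (z - deg a) (y a)) = _
  rw [coeff_polyComp]
  simp only [eq_sub_iff_add_eq]

lemma freeComp_of_homogeneous {w : σ → ℕ} {deg : ι → ℕ} {n : ℤ} {y : ι →₀ MvPolynomial σ k}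
    (hy : ∀ a m, coeff m (y a) ≠ 0 → (Finsupp.weight w m : ℤ) + deg a = n) (z : ℤ) :
    freeComp w deg z y = if n = z then y else 0 := by
  ext a m
  rw [coeff_freeComp]
  by_cases h : coeff m (y a) = 0
  · split_ifs <;> simp [h]
  · rw [hy a m h]
    split_ifs <;> simp

lemma freeComp_smul_monomial {w : σ → ℕ} {deg : ι → ℕ} {n : ℕ} {y : ι →₀ MvPolynomial σ k}
    (hy : ∀ a m, coeff m (y a) ≠ 0 → Finsupp.weight w m + deg a = n) (u : σ →₀ ℕ) (c : k)
    (z : ℤ) : freeComp w deg z (monomial u c • y) =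
      if (Finsupp.weight w u : ℤ) + n = z then monomial u c • y else 0 := by
  classical
  refine freeComp_of_homogeneous (fun a m hm => ?_) z
  rw [Finsupp.smul_apply, smul_eq_mul, coeff_monomial_mul'] at hm
  split_ifs at hm with h
  · have := hy a (m - u) (right_ne_zero_of_mul hm)
    rw [← this, ← tsub_add_cancel_of_le h, map_add]
    push_cast
    rw [add_tsub_cancel_right]
    ring
  · exact absurd rfl hm

lemma freeComp_single_monomial (w : σ → ℕ) (deg : ι → ℕ) (z : ℤ) (a : ι) (u : σ →₀ ℕ) (c : k) :
    freeComp w deg z (Finsupp.single a (monomial u c)) =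
      if (Finsupp.weight w u : ℤ) + deg a = z then Finsupp.single a (monomial u c) else 0 := by
  classical
  refine freeComp_of_homogeneous (fun b m hm => ?_) z
  rw [Finsupp.single_apply] at hm
  split_ifs at hm with h
  · subst h
    rw [coeff_monomial] at hm
    split_ifs at hm with h'
    · rw [h']
    · exact absurd rfl hm
  · simp at hm

lemma single_monomial (a : ι) (u : σ →₀ ℕ) (c : k) :
    Finsupp.single a (monomial u c) = monomial u c • Finsupp.single a (1 : MvPolynomial σ k) := by
  simp

lemma free_induction {P : (ι →₀ MvPolynomial σ k) → Prop} (h0 : P 0)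
    (hadd : ∀ y y', P y → P y' → P (y + y'))
    (hs : ∀ a u c, P (Finsupp.single a (monomial u c))) (y : ι →₀ MvPolynomial σ k) : P y := by
  induction y using Finsupp.induction_linear with
  | zero => exact h0
  | add y y' h h' => exact hadd _ _ h h'
  | single a q =>
    induction q using MvPolynomial.induction_on' with
    | monomial u c => exact hs a u c
    | add q q' h h' => rw [Finsupp.single_add]; exact hadd _ _ h h'

/-- A linear map given by a homogeneous matrix commutes with the projections to the graded
components. -/
lemma map_freeComp {w : σ → ℕ} {deg : ι → ℕ} {deg' : κ → ℕ}
    {D : (κ →₀ MvPolynomial σ k) →ₗ[MvPolynomial σ k] (ι →₀ MvPolynomial σ k)}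
    (hD : ∀ b a m, coeff m (D (Finsupp.single b 1) a) ≠ 0 → Finsupp.weight w m + deg a = deg' b)
    (z : ℤ) (y : κ →₀ MvPolynomial σ k) :
    D (freeComp w deg' z y) = freeComp w deg z (D y) := by
  induction y using free_induction with
  | h0 => simp
  | hadd y y' h h' => simp [h, h']
  | hs b u c =>
    rw [freeComp_single_monomial, single_monomial, map_smul,
      freeComp_smul_monomial (fun a m hm => hD b a m hm)]
    split_ifs
    · rw [map_smul]
    · rw [map_zero]

lemma exists_sum_freeComp [Finite ι] (w : σ → ℕ) (deg : ι → ℕ) (y : ι →₀ MvPolynomial σ k) :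
    ∃ s : Finset ℕ, y = ∑ j ∈ s, freeComp w deg (j : ℤ) y := by
  classical
  cases nonempty_fintype ι
  refine ⟨Finset.univ.biUnion fun a => (y a).support.image fun m => Finsupp.weight w m + deg a, ?_⟩
  ext a m
  rw [Finsupp.finsetSum_apply, coeff_sum]
  simp only [coeff_freeComp]
  by_cases h : coeff m (y a) = 0
  · simp [h]
  · rw [Finset.sum_eq_single (Finsupp.weight w m + deg a)]
    · simp
    · intro j _ hj
      rw [if_neg]
      exact_mod_cast hj.symm
    · intro hn
      refine absurd ?_ hn
      simp only [Finset.mem_biUnion, Finset.mem_univ, true_and, Finset.mem_image, mem_support_iff]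
      exact ⟨a, m, h, rfl⟩

lemma freeComp_freeComp (w : σ → ℕ) (deg : ι → ℕ) (z : ℤ) (y : ι →₀ MvPolynomial σ k) :
    freeComp w deg z (freeComp w deg z y) = freeComp w deg z y := by
  ext a m
  simp only [coeff_freeComp]
  split_ifs <;> rfl

lemma freeComp_X_smul (w : σ → ℕ) (deg : ι → ℕ) (z : ℤ) (s : σ) (y : ι →₀ MvPolynomial σ k) :
    freeComp w deg (z + w s) ((X s : MvPolynomial σ k) • y) =
      (X s : MvPolynomial σ k) • freeComp w deg z y := by
  induction y using free_induction with
  | h0 => rw [smul_zero, map_zero, map_zero, smul_zero]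
  | hadd y y' h h' => rw [smul_add, map_add, h, h', map_add, smul_add]
  | hs b u c =>
    have : (X s : MvPolynomial σ k) • Finsupp.single b (monomial u c) =
        Finsupp.single b (monomial (Finsupp.single s 1 + u) c) := by
      rw [Finsupp.smul_single, smul_eq_mul, X, monomial_mul, one_mul]
    rw [this, freeComp_single_monomial, freeComp_single_monomial, map_add, Finsupp.weight_single,
      smul_ite, this, smul_zero]
    refine if_congr ?_ rfl rfl
    push_cast
    constructor <;> intro h <;> simp at h ⊢ <;> linarith

variable [Fintype σ]

/-- The graded free module `⨁ₐ R(-deg a)`. -/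
noncomputable def freeOperators (w : σ → ℕ) (deg : ι → ℕ) :
    GradedOperators w (ι →₀ MvPolynomial σ k) where
  x s := DistribSMul.toAddMonoidHom (ι →₀ MvPolynomial σ k) (X s : MvPolynomial σ k)
  comm s t y := smul_comm (X s : MvPolynomial σ k) (X t : MvPolynomial σ k) y
  comp z := (freeComp w deg z).toAddMonoidHom
  comp_comp z y := freeComp_freeComp w deg z y
  comp_x z s y := freeComp_X_smul w deg z s y

@[simp] lemma freeOperators_x (w : σ → ℕ) (deg : ι → ℕ) (s : σ) (y : ι →₀ MvPolynomial σ k) :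
    (freeOperators w deg).x s y = (X s : MvPolynomial σ k) • y := rfl

@[simp] lemma freeOperators_comp (w : σ → ℕ) (deg : ι → ℕ) (z : ℤ) (y : ι →₀ MvPolynomial σ k) :
    (freeOperators w deg).comp z y = freeComp w deg z y := rfl

variable [LinearOrder σ]

/-- The exponent of `∏ s ∈ T, x_s`. -/
noncomputable def setExponent (T : Finset σ) : σ →₀ ℕ :=
  Finsupp.equivFunOnFinite.symm fun s => if s ∈ T then 1 else 0

@[simp] lemma setExponent_apply (T : Finset σ) (s : σ) :
    setExponent T s = if s ∈ T then 1 else 0 := rfl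

/-- The strand of multidegree `μ` of the `a`-th coordinate of a Koszul chain. -/
noncomputable def strand (μ : σ →₀ ℕ) (a : ι) (f : Finset σ → ι →₀ MvPolynomial σ k)
    (T : Finset σ) : k :=
  open Classical in if setExponent T ≤ μ then coeff (μ - setExponent T) (f T a) else 0

lemma strand_add_setExponent (m : σ →₀ ℕ) (a : ι) (f : Finset σ → ι →₀ MvPolynomial σ k)
    (T : Finset σ) : strand (m + setExponent T) a f T = coeff m (f T a) := by
  rw [strand, if_pos le_add_self, add_tsub_cancel_right]

lemma setExponent_le_iff (T : Finset σ) (μ : σ →₀ ℕ) :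
    setExponent T ≤ μ ↔ ∀ s ∈ T, μ s ≠ 0 := by
  rw [Finsupp.le_def]
  refine forall_congr' fun s => ?_
  rw [setExponent_apply]
  split_ifs with h <;> simp [h, Nat.one_le_iff_ne_zero]

/-- The multidegree `μ` determines the monomial attached to each `T`, so multiplication by `x_s`
becomes the identity on coefficients. The strand is the chain complex of the simplex on the support
of `μ`. -/
lemma strand_koszulD (w : σ → ℕ) (deg : ι → ℕ) (μ : σ →₀ ℕ) (a : ι)
    (f : Finset σ → ι →₀ MvPolynomial σ k) :
    strand μ a (koszulD (freeOperators w deg).x f) =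
      koszulD (fun _ => AddMonoidHom.id k) (strand μ a f) := by
  ext T
  rw [koszulD_apply, strand, koszulD_apply]
  split_ifs with h
  · rw [Finsupp.finsetSum_apply, coeff_sum]
    refine Finset.sum_congr rfl fun s hs => ?_
    rw [Finset.mem_compl] at hs
    rw [Finsupp.smul_apply, ← Int.cast_smul_eq_zsmul k, coeff_smul, ← Int.cast_smul_eq_zsmul k]
    congr 1
    rw [freeOperators_x, Finsupp.smul_apply, smul_eq_mul, coeff_X_mul', AddMonoidHom.id_apply,
      strand]
    have h1 : s ∈ (μ - setExponent T).support ↔ μ s ≠ 0 := by simp [hs]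
    have h2 : setExponent (insert s T) ≤ μ ↔ μ s ≠ 0 := by
      rw [setExponent_le_iff] at h ⊢
      simp only [Finset.forall_mem_insert, and_iff_left_iff_imp]
      exact fun _ => h
    have h3 : μ - setExponent T - Finsupp.single s 1 = μ - setExponent (insert s T) := by
      rw [tsub_tsub]
      congr 1
      ext t
      by_cases hts : t = s
      · subst hts; simp [hs]
      · simp [hts]
    simp only [h1, h2, h3]
  · symm
    refine Finset.sum_eq_zero fun s hs => ?_
    rw [AddMonoidHom.id_apply, strand, if_neg, smul_zero]
    rw [setExponent_le_iff] at h ⊢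
    exact fun h' => h fun t ht => h' t (Finset.mem_insert_of_mem ht)

lemma eq_of_strand_eq {f g : Finset σ → ι →₀ MvPolynomial σ k}
    (h : ∀ μ a, strand μ a f = strand μ a g) : f = g := by
  ext T a m
  rw [← strand_add_setExponent, h, strand_add_setExponent]

/-- The Koszul complex of a free module is exact, except that in degree `0` the coefficients must
have no constant term. -/
lemma exists_koszulD_eq [Nonempty σ] [Finite ι] (w : σ → ℕ) (deg : ι → ℕ)
    (f : Finset σ → ι →₀ MvPolynomial σ k) (hf : koszulD (freeOperators w deg).x f = 0)
    (h0 : ∀ a, coeff 0 (f ∅ a) = 0) : ∃ g, koszulD (freeOperators w deg).x g = f := by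
  -- The apex of the cone must be a vertex of the simplex on the support of `μ`, which is possible
  -- unless `μ = 0`.
  have hv : ∀ μ : σ →₀ ℕ, ∃ v, μ ≠ 0 → μ v ≠ 0 := fun μ => by
    by_cases h : μ = 0
    · exact ⟨Classical.arbitrary σ, fun h' => absurd h h'⟩
    · obtain ⟨v, hv⟩ := Finsupp.ne_iff.1 h
      exact ⟨v, fun _ => hv⟩
  choose v hv using hv
  -- In multidegree `0` only the empty set occurs, with the constant term excluded by `h0`.
  have hz : ∀ a, strand 0 a f = 0 := fun a => by
    ext T
    rw [strand]
    split_ifs with h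
    · have : T = ∅ := by
        rw [setExponent_le_iff] at h
        exact Finset.eq_empty_of_forall_notMem fun s hs => h s hs rfl
      subst this
      simpa using h0 a
    · rfl
  -- The cones of all strands assemble to a polynomial: a nonzero coefficient at `m` forces `m +
  -- e_s` into the support of `f (T.erase s) a` for some `s ∈ T`, leaving finitely many `m`.
  have key : ∀ T a, ∃ q : MvPolynomial σ k, ∀ m, coeff m q =
      cone (v (m + setExponent T)) (strand (m + setExponent T) a f) T := fun T a => by
    refine exists_coeff_eq _ (Set.Finite.subset (s := ⋃ s ∈ (T : Set σ),
      (fun m => m + Finsupp.single s 1) ⁻¹' ((f (T.erase s) a).support : Set (σ →₀ ℕ))) ?_ ?_)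
    · refine Set.Finite.biUnion T.finite_toSet fun s _ => ?_
      exact (Finset.finite_toSet _).preimage (add_left_injective _).injOn
    · intro m hm
      rw [Function.mem_support, cone] at hm
      split_ifs at hm with h
      · simp only [Set.mem_iUnion]
        refine ⟨v (m + setExponent T), h, ?_⟩
        generalize v (m + setExponent T) = s at h hm
        have e : m + setExponent T = (m + Finsupp.single s 1) + setExponent (T.erase s) := by
          ext t
          by_cases hts : t = s
          · subst hts; simp [h]
          · simp [hts]
        rw [e, strand_add_setExponent] at hm
        simp only [Set.mem_preimage, Finset.mem_coe, mem_support_iff]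
        intro h'
        simp [h'] at hm
      · exact absurd rfl hm
  choose q hq using key
  have hg : ∀ μ a, strand μ a (fun T => Finsupp.equivFunOnFinite.symm (q T)) =
      cone (v μ) (strand μ a f) := fun μ a => by
    ext T
    by_cases h : setExponent T ≤ μ
    · obtain ⟨m, rfl⟩ := exists_add_of_le h
      rw [add_comm, strand_add_setExponent]
      exact hq T a m
    · rw [strand, if_neg h, cone]
      by_cases hμ : μ = 0
      · subst hμ
        simp [hz]
      split_ifs with hT
      · rw [strand, if_neg, smul_zero]
        rw [setExponent_le_iff] at h ⊢
        refine fun h' => h fun s hs => ?_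
        by_cases hsv : s = v μ
        · rw [hsv]
          exact hv μ hμ
        · exact h' s (Finset.mem_erase.2 ⟨hsv, hs⟩)
      · rfl
  refine ⟨fun T => Finsupp.equivFunOnFinite.symm (q T), eq_of_strand_eq fun μ a => ?_⟩
  rw [strand_koszulD, hg]
  have := koszulD_cone (v μ) (strand μ a f)
  rw [← strand_koszulD, hf] at this
  convert this using 1
  symm
  rw [add_eq_left]
  ext T
  simp [cone, strand]

end FreeModule

/-! ### Doubly infinite Laurent series as a graded module -/

section Laurent

variable {σ : Type*} [Fintype σ]

/-- The doubly infinite Laurent series over `k`, on which `x_s` acts as multiplication by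
`t ^ w s`. -/
def laurentOperators (k : Type*) [Field k] (w : σ → ℕ) : GradedOperators w (ℤ → k) where
  x s :=
    { toFun := fun f z => f (z - w s)
      map_zero' := rfl
      map_add' := fun _ _ => rfl }
  comm s t f := by
    ext z
    change f (z - w s - w t) = f (z - w t - w s)
    rw [sub_right_comm]
  comp z :=
    { toFun := fun f => Pi.single z (f z)
      map_zero' := by simp
      map_add' := fun f g => by simp [Pi.single_add] }
  comp_comp z f := by simp
  comp_x z s f := by
    ext n
    simp only [AddMonoidHom.coe_mk, ZeroHom.coe_mk, Pi.single_apply, add_sub_cancel_right,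
      sub_eq_iff_eq_add]

@[simp] lemma laurentOperators_x {k : Type*} [Field k] (w : σ → ℕ) (s : σ) (f : ℤ → k) (z : ℤ) :
    (laurentOperators k w).x s f z = f (z - w s) := rfl

@[simp] lemma laurentOperators_comp {k : Type*} [Field k] (w : σ → ℕ) (z : ℤ) (f : ℤ → k) :
    (laurentOperators k w).comp z f = Pi.single z (f z) := rfl

end Laurent

/-! ### The semigroup ring inside Laurent series -/

section SemigroupRingEmbedding

variable (k : Type*) [Field k] (A : Finset ℕ)

lemma phi_monomial (m : A →₀ ℕ) (c : k) :
    phi k A (monomial m c) = Polynomial.monomial (Finsupp.weight (weights A) m) c := by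
  rw [phi, aeval_monomial, ← Polynomial.C_mul_X_pow_eq_monomial, Finsupp.weight_apply,
    Finsupp.sum, ← Finset.prod_pow_eq_pow_sum]
  congr 1
  refine Finset.prod_congr rfl fun s _ => ?_
  change ((Polynomial.X : Polynomial k) ^ (s : ℕ)) ^ m s = Polynomial.X ^ (m s * (s : ℕ))
  rw [← pow_mul, mul_comm]

lemma coeff_phi (q : MvPolynomial A k) (n : ℕ) : (phi k A q).coeff n =
    ∑ m ∈ q.support, if Finsupp.weight (weights A) m = n then coeff m q else 0 := by
  conv_lhs => rw [q.as_sum]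
  simp only [map_sum, Polynomial.finsetSum_coeff, phi_monomial, Polynomial.coeff_monomial]

/-- The embedding of `k[A]` into the doubly infinite Laurent series. -/
noncomputable def embed : SemigroupRing k A →+ (ℤ → k) :=
  ({ toFun := fun f z => if 0 ≤ z then f.coeff z.toNat else 0
     map_zero' := by ext; simp
     map_add' := fun f g => by ext z; by_cases h : 0 ≤ z <;> simp [h] } :
    Polynomial k →+ (ℤ → k)).comp (Ideal.kerLiftAlg (phi k A)).toLinearMap.toAddMonoidHom

lemma embed_mk (q : MvPolynomial A k) (z : ℤ) :
    embed k A (Ideal.Quotient.mk (definingIdeal k A) q) z =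
      if 0 ≤ z then (phi k A q).coeff z.toNat else 0 := rfl

lemma embed_injective : Function.Injective (embed k A) := by
  intro y y' h
  refine Ideal.kerLiftAlg_injective (phi k A) ?_
  ext n
  have := congrFun h n
  change (if 0 ≤ (n : ℤ) then (Ideal.kerLiftAlg (phi k A) y).coeff (n : ℤ).toNat else 0) =
    (if 0 ≤ (n : ℤ) then (Ideal.kerLiftAlg (phi k A) y').coeff (n : ℤ).toNat else 0) at this
  simpa using this

lemma embed_smul (s : A) (y : SemigroupRing k A) :
    embed k A ((X s : MvPolynomial A k) • y) =
      (laurentOperators k (weights A)).x s (embed k A y) := by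
  obtain ⟨q, rfl⟩ := Ideal.Quotient.mk_surjective y
  have : (X s : MvPolynomial A k) • Ideal.Quotient.mk (definingIdeal k A) q =
    Ideal.Quotient.mk (definingIdeal k A) (X s * q) := rfl
  ext z
  rw [this, laurentOperators_x, embed_mk, embed_mk, map_mul]
  have hX : phi k A (X s) = Polynomial.X ^ (s : ℕ) := aeval_X _ _
  rw [hX, Polynomial.coeff_X_pow_mul', weights]
  by_cases h : 0 ≤ z
  · by_cases h' : (s : ℕ) ≤ z.toNat
    · rw [if_pos h, if_pos h', if_pos (by omega)]
      congr 1
      omega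
    · rw [if_pos h, if_neg h', if_neg (by omega)]
  · rw [if_neg h, if_neg (by omega)]

lemma comp_embed_of_mem {n : ℕ} {y : SemigroupRing k A} (hy : y ∈ component k A n) (z : ℤ) :
    (laurentOperators k (weights A)).comp z (embed k A y) =
      if (n : ℤ) = z then embed k A y else 0 := by
  obtain ⟨q, hq, rfl⟩ := hy
  have h0 : ∀ z' : ℤ, z' ≠ n → embed k A (Ideal.Quotient.mk (definingIdeal k A) q) z' = 0 := by
    intro z' hz
    rw [embed_mk]
    split_ifs with h
    · rw [coeff_phi]
      refine Finset.sum_eq_zero fun m hm => if_neg fun h' => hz ?_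
      have := (mem_weightedHomogeneousSubmodule _ _ _ _).1 hq (mem_support_iff.1 hm)
      omega
    · rfl
  change (laurentOperators k (weights A)).comp z (embed k A (Ideal.Quotient.mk _ q)) =
    if (n : ℤ) = z then embed k A (Ideal.Quotient.mk _ q) else 0
  ext z'
  rw [laurentOperators_comp]
  split_ifs with h
  · subst h
    by_cases h : z' = n
    · subst h; simp
    · rw [Pi.single_eq_of_ne h, h0 z' h]
  · rw [h0 z (Ne.symm h)]
    simp

lemma monomial_smul_mem_component {n : ℕ} {y : SemigroupRing k A} (hy : y ∈ component k A n)
    (u : A →₀ ℕ) (c : k) :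
    (monomial u c : MvPolynomial A k) • y ∈
      component k A (Finsupp.weight (weights A) u + n) := by
  obtain ⟨q, hq, rfl⟩ := hy
  exact ⟨monomial u c * q, (mem_weightedHomogeneousSubmodule _ _ _ _).2
    ((isWeightedHomogeneous_monomial _ _ _ rfl).mul hq), rfl⟩

/-- A homogeneous map from a free module to `k[A]` commutes with the gradings. -/
lemma isHom_embed {ι : Type*} {deg : ι → ℕ}
    {ε : (ι →₀ MvPolynomial A k) →ₗ[MvPolynomial A k] SemigroupRing k A}
    (hε : ∀ a, ε (Finsupp.single a 1) ∈ component k A (deg a)) :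
    GradedOperators.IsHom (freeOperators (weights A) deg) (laurentOperators k (weights A))
      ((embed k A).comp ε.toAddMonoidHom) where
  map_x s y := by
    change embed k A (ε ((X s : MvPolynomial A k) • y)) = _
    rw [map_smul, embed_smul]
    rfl
  map_comp z y := by
    rw [freeOperators_comp]
    change embed k A (ε _) = (laurentOperators k (weights A)).comp z (embed k A (ε _))
    induction y using free_induction with
    | h0 => simp only [map_zero]
    | hadd y y' h h' => simp only [map_add, h, h']
    | hs a u c =>
      rw [freeComp_single_monomial, single_monomial, map_smul,
        comp_embed_of_mem k A (monomial_smul_mem_component k A (hε a) u c)]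
      push_cast
      split_ifs
      · rw [map_smul]
      · rw [map_zero, map_zero]

lemma weight_mem_gen (m : A →₀ ℕ) : Finsupp.weight (weights A) m ∈ gen A := by
  rw [Finsupp.weight_apply]
  exact sum_mem fun s _ => nsmul_mem (AddSubmonoid.subset_closure s.2) _

lemma exists_weight_eq {n : ℕ} (hn : n ∈ gen A) :
    ∃ m : A →₀ ℕ, Finsupp.weight (weights A) m = n := by
  induction hn using AddSubmonoid.closure_induction with
  | mem a ha => exact ⟨Finsupp.single ⟨a, ha⟩ 1, by simp [Finsupp.weight_single, weights]⟩
  | zero => exact ⟨0, map_zero _⟩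
  | add a b _ _ h h' =>
    obtain ⟨m, rfl⟩ := h
    obtain ⟨m', rfl⟩ := h'
    exact ⟨m + m', map_add _ _ _⟩

lemma exists_mem_gen_of_embed_ne_zero {y : SemigroupRing k A} {z : ℤ} (h : embed k A y z ≠ 0) :
    ∃ n ∈ gen A, (n : ℤ) = z := by
  obtain ⟨q, rfl⟩ := Ideal.Quotient.mk_surjective y
  rw [embed_mk] at h
  split_ifs at h with hz
  · rw [coeff_phi] at h
    obtain ⟨m, _, hm⟩ := Finset.exists_ne_zero_of_sum_ne_zero h
    refine ⟨_, weight_mem_gen A m, ?_⟩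
    split_ifs at hm with h'
    · omega
    · exact absurd rfl hm
  · exact absurd rfl h

/-- Together with `exists_mem_gen_of_embed_ne_zero`, this reduces membership of a single term `c
t^z` in the image, for `c ≠ 0`, to `z ∈ ⟨A⟩`. -/
lemma single_mem_range_embed {n : ℕ} (hn : n ∈ gen A) (c : k) :
    (Pi.single (n : ℤ) c : ℤ → k) ∈ (embed k A).range := by
  obtain ⟨m, rfl⟩ := exists_weight_eq A hn
  refine ⟨Ideal.Quotient.mk _ (monomial m c), ?_⟩
  ext z
  rw [embed_mk, phi_monomial, Polynomial.coeff_monomial, Pi.single_apply]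
  by_cases h : 0 ≤ z
  · rw [if_pos h]
    refine if_congr ?_ rfl rfl
    omega
  · rw [if_neg h, if_neg (by omega)]

end SemigroupRingEmbedding

/-! ### Existence of minimal graded free resolutions -/

section Existence

lemma eq_zero_of_weight_eq_zero {σ : Type*} [Fintype σ] {w : σ → ℕ} (hw : ∀ s, 0 < w s)
    {m : σ →₀ ℕ} (h : Finsupp.weight w m = 0) : m = 0 := by
  rw [Finsupp.weight_apply, Finsupp.sum_fintype _ _ (by simp), Finset.sum_eq_zero_iff] at h
  ext s
  have := h s (Finset.mem_univ s)
  simpa [(hw s).ne'] using this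

variable {k σ ι : Type*} [Field k] [Fintype σ] [LinearOrder σ] [Nonempty σ]

lemma exists_eq_sum_X_smul [Finite ι] {y : ι →₀ MvPolynomial σ k} (hy : ∀ a, coeff 0 (y a) = 0) :
    ∃ g : σ → ι →₀ MvPolynomial σ k, y = ∑ s, (X s : MvPolynomial σ k) • g s := by
  -- An element placed at the empty set is automatically a cycle. The grading plays no role here, so
  -- all weights and degrees are set to `0`.
  obtain ⟨g, hg⟩ := exists_koszulD_eq (0 : σ → ℕ) (0 : ι → ℕ) (fun T => if T = ∅ then y else 0)
    (by ext1 T; rw [koszulD_apply]; simp) (by simpa using hy)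
  refine ⟨fun s => koszulSign s ∅ • g {s}, ?_⟩
  have := congrFun hg ∅
  rw [koszulD_apply, if_pos rfl] at this
  rw [← this, Finset.compl_empty]
  refine Finset.sum_congr rfl fun s _ => ?_
  rw [freeOperators_x, smul_comm, insert_empty_eq]

/-- Translates minimality into the absence of constant terms, the form required by the Koszul
argument. -/
lemma mem_span_X_smul_top_iff [Finite ι] (y : ι →₀ MvPolynomial σ k) :
    y ∈ Ideal.span (Set.range (X : σ → MvPolynomial σ k)) •
      (⊤ : Submodule (MvPolynomial σ k) (ι →₀ MvPolynomial σ k)) ↔ ∀ a, coeff 0 (y a) = 0 := by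
  constructor
  · intro h a
    induction h using Submodule.smul_induction_on' with
    | smul r hr n _ =>
      have : Ideal.span (Set.range (X : σ → MvPolynomial σ k)) ≤
          RingHom.ker (constantCoeff : MvPolynomial σ k →+* k) := by
        rw [Ideal.span_le]
        rintro _ ⟨s, rfl⟩
        simp
      have h0 := this hr
      rw [RingHom.mem_ker] at h0
      rw [Finsupp.smul_apply, smul_eq_mul, ← constantCoeff_eq, map_mul, h0, zero_mul]
    | add y _ y' _ h h' => rw [Finsupp.add_apply, coeff_add, h, h', add_zero]
  · intro h
    obtain ⟨g, rfl⟩ := exists_eq_sum_X_smul h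
    exact sum_mem fun s _ => Submodule.smul_mem_smul (Ideal.subset_span ⟨s, rfl⟩) trivial

/-- `n` homogeneous elements of a graded free module which generate `Z`. -/
def IsHomogeneousGenerators (w : σ → ℕ) (deg : ι → ℕ)
    (Z : Submodule (MvPolynomial σ k) (ι →₀ MvPolynomial σ k)) {n : ℕ} (deg' : Fin n → ℕ)
    (v : Fin n → ι →₀ MvPolynomial σ k) : Prop :=
  (∀ b a m, coeff m (v b a) ≠ 0 → Finsupp.weight w m + deg a = deg' b) ∧
    Submodule.span (MvPolynomial σ k) (Set.range v) = Z

lemma exists_homogeneousGenerators [Finite ι] (w : σ → ℕ) (deg : ι → ℕ)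
    (Z : Submodule (MvPolynomial σ k) (ι →₀ MvPolynomial σ k))
    (hZ : ∀ y ∈ Z, ∀ j : ℤ, freeComp w deg j y ∈ Z) :
    ∃ (n : ℕ) (deg' : Fin n → ℕ) (v : Fin n → ι →₀ MvPolynomial σ k),
      IsHomogeneousGenerators w deg Z deg' v := by
  classical
  obtain ⟨S, hS⟩ := (isNoetherian_def.1 (inferInstance :
    IsNoetherian (MvPolynomial σ k) (ι →₀ MvPolynomial σ k))) Z
  choose s hs using fun y : ι →₀ MvPolynomial σ k => exists_sum_freeComp w deg y
  let S' : Finset (ι →₀ MvPolynomial σ k) :=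
    S.biUnion fun y => (s y).image fun j : ℕ => freeComp w deg (j : ℤ) y
  have hS' : ∀ y : S', ∃ j : ℕ, ∃ x ∈ S, freeComp w deg (j : ℤ) x = y := by
    rintro ⟨y, hy⟩
    simp only [S', Finset.mem_biUnion, Finset.mem_image] at hy
    obtain ⟨x, hx, j, _, hj⟩ := hy
    exact ⟨j, x, hx, hj⟩
  choose d hd using hS'
  let e := S'.equivFin.symm
  refine ⟨S'.card, fun b => d (e b), fun b => e b, fun b a m hm => ?_, ?_⟩
  · obtain ⟨x, _, hx⟩ := hd (e b)
    change coeff m ((e b : ι →₀ MvPolynomial σ k) a) ≠ 0 at hm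
    rw [← hx, coeff_freeComp] at hm
    split_ifs at hm with h
    · exact_mod_cast h
    · exact absurd rfl hm
  · have hr : Set.range (fun b => (e b : ι →₀ MvPolynomial σ k)) = S' := by
      ext y
      constructor
      · rintro ⟨b, rfl⟩
        exact (e b).2
      · intro hy
        exact ⟨e.symm ⟨y, hy⟩, by simp⟩
    rw [hr]
    refine le_antisymm (Submodule.span_le.2 fun y hy => ?_) ?_
    · obtain ⟨x, hxS, hx⟩ := hd ⟨y, hy⟩
      simp only at hx
      rw [← hx]
      exact hZ x (hS ▸ Submodule.subset_span hxS) _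
    · rw [← hS, Submodule.span_le]
      intro y hy
      rw [hs y]
      refine sum_mem fun j hj => Submodule.subset_span ?_
      exact Finset.mem_biUnion.2 ⟨y, hy, Finset.mem_image_of_mem _ hj⟩

/-- A homogeneous submodule of a graded free module has a minimal homogeneous presentation by a
graded free module. -/
lemma exists_minimal_cover [Finite ι] {w : σ → ℕ} (hw : ∀ s, 0 < w s) (deg : ι → ℕ)
    (Z : Submodule (MvPolynomial σ k) (ι →₀ MvPolynomial σ k))
    (hZ : ∀ y ∈ Z, ∀ j : ℤ, freeComp w deg j y ∈ Z) :
    ∃ (n : ℕ) (deg' : Fin n → ℕ)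
      (D : (Fin n →₀ MvPolynomial σ k) →ₗ[MvPolynomial σ k] (ι →₀ MvPolynomial σ k)),
      (∀ b a m, coeff m (D (Finsupp.single b 1) a) ≠ 0 →
        Finsupp.weight w m + deg a = deg' b) ∧
      LinearMap.range D = Z ∧ ∀ y, D y = 0 → ∀ a, coeff 0 (y a) = 0 := by
  classical
  -- Take the least possible number of homogeneous generators; a relation with a constant term would
  -- make one of them redundant.
  have hex := exists_homogeneousGenerators w deg Z hZ
  obtain ⟨deg', v, hv, hspan⟩ := Nat.find_spec hex
  have hmin : ∀ n < Nat.find hex, _ := fun n hn => Nat.find_min hex hn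
  generalize Nat.find hex = n at deg' v hv hspan hmin
  have hD : ∀ b a m, coeff m (Finsupp.linearCombination (MvPolynomial σ k) v
      (Finsupp.single b 1) a) ≠ 0 → Finsupp.weight w m + deg a = deg' b := by
    intro b a m h
    rw [Finsupp.linearCombination_single, one_smul] at h
    exact hv b a m h
  refine ⟨n, deg', Finsupp.linearCombination _ v, hD, ?_, fun y hy b => ?_⟩
  · rw [Finsupp.range_linearCombination, hspan]
  by_contra hne
  obtain ⟨n, rfl⟩ : ∃ n', n = n' + 1 := ⟨n - 1, by have := b.2; omega⟩
  have hy' := map_freeComp hD (deg' b : ℤ) y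
  rw [hy, map_zero] at hy'
  -- In the part of the relation of degree `deg' b`, the coefficient of `v b` has weight `0`. Since
  -- weights are positive it is a scalar, hence a unit.
  have hb : freeComp w deg' (deg' b : ℤ) y b = C (coeff 0 (y b)) := by
    ext m
    rw [coeff_freeComp, coeff_C]
    by_cases hm : m = 0
    · subst hm
      simp
    · rw [if_neg, if_neg (Ne.symm hm)]
      intro h
      exact hm (eq_zero_of_weight_eq_zero hw (by omega))
  generalize freeComp w deg' (deg' b : ℤ) y = y' at hy' hb
  rw [Finsupp.linearCombination_apply, Finsupp.sum_fintype _ _ (by simp),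
    Fin.sum_univ_succAbove _ b, hb] at hy'
  refine hmin n (Nat.lt_succ_self n) ⟨fun i => deg' (b.succAbove i), fun i => v (b.succAbove i),
    fun i => hv _, ?_⟩
  refine le_antisymm (Submodule.span_le.2 ?_) ?_
  · rintro _ ⟨i, rfl⟩
    exact hspan ▸ Submodule.subset_span ⟨_, rfl⟩
  · rw [← hspan, Submodule.span_le]
    rintro _ ⟨i, rfl⟩
    rcases Fin.eq_self_or_eq_succAbove b i with rfl | ⟨i, rfl⟩
    · rw [add_eq_zero_iff_eq_neg] at hy'
      have h1 : v i = (C (coeff 0 (y i))⁻¹ : MvPolynomial σ k) •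
          (C (coeff 0 (y i)) : MvPolynomial σ k) • v i := by
        rw [smul_smul, ← C_mul, inv_mul_cancel₀ hne, C_1, one_smul]
      rw [SetLike.mem_coe, h1, hy']
      refine Submodule.smul_mem _ _ (Submodule.neg_mem _ (sum_mem fun l _ => ?_))
      exact Submodule.smul_mem _ _ (Submodule.subset_span ⟨l, rfl⟩)
    · exact Submodule.subset_span ⟨i, rfl⟩

/-- A homogeneous map between graded free modules of finite rank. -/
structure GradedMatrix (k : Type*) [Field k] (w : σ → ℕ) where
  target : Type
  source : Type
  target_finite : Finite target
  source_finite : Finite source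
  targetDeg : target → ℕ
  sourceDeg : source → ℕ
  map : (source →₀ MvPolynomial σ k) →ₗ[MvPolynomial σ k] (target →₀ MvPolynomial σ k)
  homogeneous : ∀ b a m, coeff m (map (Finsupp.single b 1) a) ≠ 0 →
    Finsupp.weight w m + targetDeg a = sourceDeg b

lemma GradedMatrix.exists_cover_ker {w : σ → ℕ} (hw : ∀ s, 0 < w s) (E : GradedMatrix k w) :
    ∃ (n : ℕ) (deg' : Fin n → ℕ)
      (D : (Fin n →₀ MvPolynomial σ k) →ₗ[MvPolynomial σ k] (E.source →₀ MvPolynomial σ k)),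
      (∀ b a m, coeff m (D (Finsupp.single b 1) a) ≠ 0 →
        Finsupp.weight w m + E.sourceDeg a = deg' b) ∧
      LinearMap.range D = LinearMap.ker E.map ∧ ∀ y, D y = 0 → ∀ a, coeff 0 (y a) = 0 := by
  have := E.source_finite
  refine exists_minimal_cover hw _ _ fun y hy j => ?_
  rw [LinearMap.mem_ker] at hy ⊢
  rw [map_freeComp E.homogeneous, hy, map_zero]

/-- The next step of a minimal resolution. -/
noncomputable def GradedMatrix.next {w : σ → ℕ} (hw : ∀ s, 0 < w s) (E : GradedMatrix k w) :
    GradedMatrix k w where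
  target := E.source
  source := Fin (E.exists_cover_ker hw).choose
  target_finite := E.source_finite
  source_finite := inferInstance
  targetDeg := E.sourceDeg
  sourceDeg := (E.exists_cover_ker hw).choose_spec.choose
  map := (E.exists_cover_ker hw).choose_spec.choose_spec.choose
  homogeneous := (E.exists_cover_ker hw).choose_spec.choose_spec.choose_spec.1

lemma GradedMatrix.range_next {w : σ → ℕ} (hw : ∀ s, 0 < w s) (E : GradedMatrix k w) :
    LinearMap.range (E.next hw).map = LinearMap.ker E.map :=
  (E.exists_cover_ker hw).choose_spec.choose_spec.choose_spec.2.1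

lemma GradedMatrix.coeff_zero_of_next_eq_zero {w : σ → ℕ} (hw : ∀ s, 0 < w s)
    (E : GradedMatrix k w) (y : (E.next hw).source →₀ MvPolynomial σ k)
    (hy : (E.next hw).map y = 0) (a : (E.next hw).source) : coeff 0 (y a) = 0 :=
  (E.exists_cover_ker hw).choose_spec.choose_spec.choose_spec.2.2 y hy a

/-- A module with a minimal homogeneous surjection from a graded free module with homogeneous
kernel has a minimal graded free resolution. -/
lemma exists_minimalGradedFreeResolution {w : σ → ℕ} (hw : ∀ s, 0 < w s)
    {M : Type*} [AddCommGroup M] [Module k M] [Module (MvPolynomial σ k) M]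
    {𝓜 : ℕ → Submodule k M} {ι : Type} [Finite ι] (deg : ι → ℕ)
    (ε : (ι →₀ MvPolynomial σ k) →ₗ[MvPolynomial σ k] M)
    (hε : ∀ a, ε (Finsupp.single a 1) ∈ 𝓜 (deg a)) (hs : Function.Surjective ε)
    (hk : ∀ y, ε y = 0 → ∀ j : ℤ, ε (freeComp w deg j y) = 0)
    (hm : ∀ y, ε y = 0 → ∀ a, coeff 0 (y a) = 0) :
    Nonempty (MinimalGradedFreeResolution w M 𝓜) := by
  obtain ⟨n, deg', D, hD, hr, hD0⟩ := exists_minimal_cover hw deg (LinearMap.ker ε) hk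
  let E₀ : GradedMatrix k w := ⟨ι, Fin n, inferInstance, inferInstance, deg, deg', D, hD⟩
  -- `E i` is the differential from step `i + 1` to step `i`.
  let E : ℕ → GradedMatrix k w := fun i => Nat.rec E₀ (fun _ E => E.next hw) i
  have hmin : ∀ i, ∀ y, (E i).map y = 0 → ∀ a, coeff 0 (y a) = 0 := by
    rintro (_ | i)
    · exact hD0
    · exact (E i).coeff_zero_of_next_eq_zero hw
  refine ⟨{
    ι := fun i => (E i).target
    finite := fun i => (E i).target_finite
    deg := fun i => (E i).targetDeg
    d := fun i => (E i).map
    ε := ε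
    ε_homogeneous := hε
    d_homogeneous := fun i => (E i).homogeneous
    ε_surjective := hs
    exact_zero := hr
    exact_succ := fun i => (E i).range_next hw
    minimal := ?_ }⟩
  rintro i _ ⟨y, rfl⟩
  have := (E i).target_finite
  rw [mem_span_X_smul_top_iff]
  rcases i with _ | i
  · refine hm _ ?_
    have : D y ∈ LinearMap.ker ε := hr ▸ ⟨y, rfl⟩
    exact this
  · refine hmin i _ ?_
    have : (E (i + 1)).map y ∈ LinearMap.ker (E i).map := (E i).range_next hw ▸ ⟨y, rfl⟩
    exact this

end Existence

namespace GradedOperators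

variable {σ N : Type*} [Fintype σ] [LinearOrder σ] [AddCommGroup N] {w : σ → ℕ}
  {G : GradedOperators w N} {i : ℕ} {j : ℤ} {f : Finset σ → N}

lemma IsHomogeneous.eq_zero (hf : G.IsHomogeneous i j f) {T : Finset σ} (hT : T.card ≠ i) :
    f T = 0 := by
  rw [← hf, proj, if_neg hT]

lemma IsHomogeneous.comp_eq (hf : G.IsHomogeneous i j f) (T : Finset σ) :
    G.comp (j - ∑ s ∈ T, (w s : ℤ)) (f T) = f T := by
  rw [← hf, proj]
  split_ifs
  · rw [G.comp_comp]
  · rw [map_zero]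

lemma isHomogeneous_of (h0 : ∀ T, T.card ≠ i → f T = 0)
    (hc : ∀ T, G.comp (j - ∑ s ∈ T, (w s : ℤ)) (f T) = f T) : G.IsHomogeneous i j f := by
  ext1 T
  rw [proj]
  split_ifs with h
  · exact hc T
  · exact (h0 T h).symm

lemma IsHomogeneous.koszulD_eq_zero (hf : G.IsHomogeneous 0 j f) :
    NumSemigroup.koszulD G.x f = 0 := by
  ext1 T
  rw [koszulD_apply]
  refine Finset.sum_eq_zero fun s _ => ?_
  rw [hf.eq_zero (by simp [Finset.card_eq_zero]), map_zero, smul_zero]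

end GradedOperators

/-! ### Koszul homology of the image of a minimal map -/

section MinimalMaps

variable {k σ ι N : Type*} [Field k] [Fintype σ] [LinearOrder σ] [Nonempty σ] [Finite ι]
  [AddCommGroup N] {w : σ → ℕ} {deg : ι → ℕ} {G : GradedOperators w N}
  {p : (ι →₀ MvPolynomial σ k) →+ N}

lemma exists_isHomogeneous_koszulD_eq {i : ℕ} {j : ℤ} {f : Finset σ → ι →₀ MvPolynomial σ k}
    (hf : (freeOperators w deg).IsHomogeneous i j f) (hc : koszulD (freeOperators w deg).x f = 0)
    (h0 : ∀ a, coeff 0 (f ∅ a) = 0) :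
    ∃ g, (freeOperators w deg).IsHomogeneous (i + 1) j g ∧
      koszulD (freeOperators w deg).x g = f := by
  obtain ⟨g, rfl⟩ := exists_koszulD_eq w deg f hc h0
  exact ⟨_, (freeOperators w deg).isHomogeneous_proj (i + 1) j g, by
    rw [GradedOperators.koszulD_proj]; exact hf⟩

lemma coeff_zero_koszulD (g : Finset σ → ι →₀ MvPolynomial σ k) (T : Finset σ) (a : ι) :
    coeff 0 (koszulD (freeOperators w deg).x g T a) = 0 := by
  rw [koszulD_apply, Finsupp.finsetSum_apply, coeff_sum]
  refine Finset.sum_eq_zero fun s _ => ?_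
  rw [Finsupp.smul_apply, ← Int.cast_smul_eq_zsmul k, coeff_smul, freeOperators_x,
    Finsupp.smul_apply, smul_eq_mul, smul_eq_mul, coeff_X_mul']
  simp

/-- By minimality, elements of the kernel have no constant terms, so cycles with values in the
kernel bound in the free module even in homological degree `0`. -/
lemma acyclic_range_succ_iff_of_minimal (hp : (freeOperators w deg).IsHom G p)
    (hm : ∀ y, p y = 0 → ∀ a, coeff 0 (y a) = 0) (i : ℕ) (j : ℤ) :
    G.Acyclic p.range (i + 1) j ↔ (freeOperators w deg).Acyclic p.ker i j := by
  refine hp.acyclic_range_succ_iff (fun f hf _ hc => ?_) fun f hf hk hc =>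
    exists_isHomogeneous_koszulD_eq hf hc (hm _ (hk ∅))
  obtain ⟨g, hg, hgf⟩ := exists_isHomogeneous_koszulD_eq hf hc
    (fun a => by rw [hf.eq_zero (by simp)]; simp)
  exact ⟨g, hg, fun _ => trivial, hgf⟩

/-- The zeroth Koszul homology is the image modulo the variables, where by minimality the basis
elements remain independent. -/
lemma acyclic_range_zero_iff_of_minimal (hp : (freeOperators w deg).IsHom G p)
    (hm : ∀ y, p y = 0 → ∀ a, coeff 0 (y a) = 0) (j : ℕ) :
    G.Acyclic p.range 0 j ↔ ∀ a, deg a ≠ j := by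
  constructor
  · rintro h a rfl
    let e : Finset σ → ι →₀ MvPolynomial σ k := fun T => if T = ∅ then Finsupp.single a 1 else 0
    have he : (freeOperators w deg).IsHomogeneous 0 (deg a) e := by
      refine GradedOperators.isHomogeneous_of (fun T hT => ?_) fun T => ?_
      · rw [Finset.card_ne_zero, Finset.nonempty_iff_ne_empty] at hT
        exact if_neg hT
      · by_cases hT : T = ∅
        · subst hT
          have := freeComp_single_monomial w deg (deg a : ℤ) a 0 (1 : k)
          simpa [e] using this
        · simp [e, hT]
    obtain ⟨g, hg, hgr, hgf⟩ := h _ (hp.isHomogeneous he) (fun T => ⟨_, rfl⟩)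
      (hp.isHomogeneous he).koszulD_eq_zero
    obtain ⟨g', hg', rfl⟩ := hp.exists_lift hg hgr
    rw [hp.map_koszulD] at hgf
    have h1 := hm (e ∅ - koszulD (freeOperators w deg).x g' ∅)
      (by rw [map_sub, sub_eq_zero]; exact (congrFun hgf ∅).symm) a
    rw [Finsupp.sub_apply, coeff_sub, coeff_zero_koszulD, sub_zero] at h1
    simp [e] at h1
  · intro h f hf hr _
    obtain ⟨f', hf', rfl⟩ := hp.exists_lift hf hr
    obtain ⟨g, hg, hgf⟩ := exists_isHomogeneous_koszulD_eq hf' hf'.koszulD_eq_zero fun a => by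
      have := hf'.comp_eq ∅
      rw [← this, freeOperators_comp, coeff_freeComp, if_neg]
      simpa using h a
    exact ⟨_, hp.isHomogeneous hg, fun T => ⟨_, rfl⟩, by rw [hp.map_koszulD, hgf]⟩

end MinimalMaps

/-! ### Betti numbers from Koszul homology -/

section Betti

variable {k : Type*} [Field k]

namespace MinimalGradedFreeResolution

variable {σ : Type*} [Fintype σ] [LinearOrder σ] [Nonempty σ] {w : σ → ℕ}
  {M : Type*} [AddCommGroup M] [Module k M] [Module (MvPolynomial σ k) M] {𝓜 : ℕ → Submodule k M}
  (F : MinimalGradedFreeResolution w M 𝓜)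

lemma betti_ne_zero_iff (i j : ℕ) : F.betti i j ≠ 0 ↔ ∃ a, F.deg i a = j := by
  have := F.finite i
  rw [betti, Nat.card_ne_zero, nonempty_subtype]
  exact and_iff_left inferInstance

lemma coeff_zero_d (i : ℕ) (y : F.ι (i + 1) →₀ MvPolynomial σ k) (a : F.ι i) :
    coeff 0 (F.d i y a) = 0 := by
  have := F.finite i
  exact (mem_span_X_smul_top_iff _).1 (F.minimal i ⟨y, rfl⟩) a

lemma coeff_zero_of_d_eq_zero (i : ℕ) (y : F.ι (i + 1) →₀ MvPolynomial σ k) (hy : F.d i y = 0)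
    (a : F.ι (i + 1)) : coeff 0 (y a) = 0 := by
  have : y ∈ LinearMap.range (F.d (i + 1)) := F.exact_succ i ▸ hy
  obtain ⟨x, rfl⟩ := this
  exact F.coeff_zero_d (i + 1) x a

lemma coeff_zero_of_ε_eq_zero (y : F.ι 0 →₀ MvPolynomial σ k) (hy : F.ε y = 0)
    (a : F.ι 0) : coeff 0 (y a) = 0 := by
  have : y ∈ LinearMap.range (F.d 0) := F.exact_zero ▸ hy
  obtain ⟨x, rfl⟩ := this
  exact F.coeff_zero_d 0 x a

lemma isHom_d (i : ℕ) : GradedOperators.IsHom (freeOperators w (F.deg (i + 1)))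
    (freeOperators w (F.deg i)) (F.d i).toAddMonoidHom where
  map_x s y := map_smul (F.d i) (X s : MvPolynomial σ k) y
  map_comp z y := map_freeComp (F.d_homogeneous i) z y

/-- Each shift trades one Koszul degree for one step in the resolution, until degree `0` reads off
the basis of `F m`. Keeping `m` separate from `n + 1 + i` avoids transport between index types. -/
lemma acyclic_range_d_iff (j i : ℕ) : ∀ n m : ℕ, m = n + 1 + i →
    ((freeOperators w (F.deg n)).Acyclic (F.d n).toAddMonoidHom.range i j ↔
      ∀ a, F.deg m a ≠ j) := by
  induction i with
  | zero =>
    rintro n _ rfl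
    have := F.finite (n + 1)
    exact acyclic_range_zero_iff_of_minimal (F.isHom_d n) (F.coeff_zero_of_d_eq_zero n) j
  | succ i ih =>
    intro n m hm
    have := F.finite (n + 1)
    rw [acyclic_range_succ_iff_of_minimal (F.isHom_d n) (F.coeff_zero_of_d_eq_zero n),
      ← ih (n + 1) m (by omega)]
    have : (F.d n).toAddMonoidHom.ker = (F.d (n + 1)).toAddMonoidHom.range := by
      ext y
      exact (SetLike.ext_iff.1 (F.exact_succ n) y).symm
    rw [this]

/-- The Betti numbers are detected by the Koszul homology of the resolved module. -/
lemma betti_ne_zero_iff_not_acyclic {N : Type*} [AddCommGroup N] {G : GradedOperators w N}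
    {e : M →+ N} (he : Function.Injective e)
    (hp : (freeOperators w (F.deg 0)).IsHom G (e.comp F.ε.toAddMonoidHom)) (i j : ℕ) :
    F.betti i j ≠ 0 ↔ ¬ G.Acyclic e.range i j := by
  have := F.finite 0
  have hr : e.range = (e.comp F.ε.toAddMonoidHom).range := by
    ext z
    constructor
    · rintro ⟨y, rfl⟩
      obtain ⟨x, rfl⟩ := F.ε_surjective y
      exact ⟨x, rfl⟩
    · rintro ⟨x, rfl⟩
      exact ⟨F.ε x, rfl⟩
  have h0 : ∀ y, (e.comp F.ε.toAddMonoidHom) y = 0 ↔ F.ε y = 0 := fun y =>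
    (injective_iff_map_eq_zero' e).1 he (F.ε y)
  have hm : ∀ y, (e.comp F.ε.toAddMonoidHom) y = 0 → ∀ a, coeff 0 (y a) = 0 := fun y hy =>
    F.coeff_zero_of_ε_eq_zero y ((h0 y).1 hy)
  rw [betti_ne_zero_iff, hr, ← not_iff_not, not_not, not_exists]
  rcases i with _ | i
  · exact (acyclic_range_zero_iff_of_minimal hp hm j).symm
  · rw [acyclic_range_succ_iff_of_minimal hp hm]
    have : (e.comp F.ε.toAddMonoidHom).ker = (F.d 0).toAddMonoidHom.range := by
      ext y
      exact (h0 y).trans (SetLike.ext_iff.1 F.exact_zero y).symm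
    rw [this]
    exact (F.acyclic_range_d_iff j i 0 (i + 1) (by omega)).symm

end MinimalGradedFreeResolution

end Betti

/-! ### Frobenius numbers, and their behaviour under gluing -/

/-- `f` is the Frobenius number of `⟨A⟩`: the greatest integer outside `⟨A⟩`. -/
def IsFrobenius (A : Finset ℕ) (f : ℤ) : Prop :=
  IsGreatest {z : ℤ | ∀ n ∈ gen A, (n : ℤ) ≠ z} f

namespace IsFrobenius

variable {A : Finset ℕ} {f : ℤ}

lemma exists_of_lt (hf : IsFrobenius A f) {z : ℤ} (hz : f < z) : ∃ n ∈ gen A, (n : ℤ) = z := by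
  by_contra! h
  exact absurd (hf.2 h) (not_le.2 hz)

lemma neg_one_le (hf : IsFrobenius A f) : -1 ≤ f :=
  hf.2 fun n _ h => by omega

lemma mk_of (h₁ : ∀ n ∈ gen A, (n : ℤ) ≠ f) (h₂ : ∀ z, f < z → ∃ n ∈ gen A, (n : ℤ) = z) :
    IsFrobenius A f :=
  ⟨h₁, fun z hz => by
    by_contra h
    obtain ⟨n, hn, hnz⟩ := h₂ z (not_le.1 h)
    exact hz n hn hnz⟩

end IsFrobenius

lemma exists_isFrobenius {A : Finset ℕ} (hA : A.gcd id = 1) : ∃ f, IsFrobenius A f := by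
  obtain ⟨b, hb⟩ := Nat.exists_mem_closure_of_ge (A : Set ℕ)
  have hg : Nat.setGcd (A : Set ℕ) = 1 := by
    rw [← Nat.dvd_one, ← hA]
    exact Finset.dvd_gcd fun a ha => Nat.setGcd_dvd_of_mem ha
  obtain ⟨f, hf, hmax⟩ := Int.exists_greatest_of_bdd
    (P := fun z => ∀ n ∈ gen A, (n : ℤ) ≠ z)
    ⟨b, fun z hz => by
      by_contra h
      refine hz z.toNat (hb _ (by omega) (by rw [hg]; exact one_dvd _)) (by omega)⟩
    -- Gaps are taken in `ℤ`, so `-1` is always one; it is the Frobenius number when `⟨A⟩ = ℕ`.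
    ⟨-1, fun n _ => by omega⟩
  exact ⟨f, hf, fun z hz => hmax z hz⟩

section Gluing

variable {A B : Finset ℕ} {k₁ k₂ : ℕ}

lemma gen_image_mul (A : Finset ℕ) (c : ℕ) :
    gen (A.image fun a => c * a) = (gen A).map (AddMonoidHom.mulLeft c) := by
  rw [gen, gen, AddMonoidHom.map_mclosure, Finset.coe_image]
  rfl

lemma mem_gen_gluing (n : ℕ) :
    n ∈ gen (A.image (fun a => k₁ * a) ∪ B.image (fun b => k₂ * b)) ↔
      ∃ a ∈ gen A, ∃ b ∈ gen B, k₁ * a + k₂ * b = n := by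
  have : gen (A.image (fun a => k₁ * a) ∪ B.image (fun b => k₂ * b)) =
      gen (A.image fun a => k₁ * a) ⊔ gen (B.image fun b => k₂ * b) := by
    rw [gen, gen, gen, Finset.coe_union, AddSubmonoid.closure_union]
  rw [this, AddSubmonoid.mem_sup, gen_image_mul, gen_image_mul]
  simp [AddSubmonoid.mem_map]

/-- The Frobenius number of a gluing. -/
lemma IsFrobenius.gluing {f₁ f₂ : ℤ} (h₁ : 0 < k₁) (h₂ : 0 < k₂) (hc : Nat.Coprime k₁ k₂)
    (hk₁ : k₁ ∈ gen B) (hk₂ : k₂ ∈ gen A) (hA : IsFrobenius A f₁) (hB : IsFrobenius B f₂) :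
    IsFrobenius (A.image (fun a => k₁ * a) ∪ B.image (fun b => k₂ * b))
      (k₁ * f₁ + k₂ * f₂ + k₁ * k₂) := by
  have hco : IsCoprime (k₁ : ℤ) (k₂ : ℤ) := Nat.isCoprime_iff_coprime.2 hc
  have h₁' : (0 : ℤ) < k₁ := by exact_mod_cast h₁
  have h₂' : (0 : ℤ) < k₂ := by exact_mod_cast h₂
  refine .mk_of (fun n hn => ?_) fun z hz => ?_
  · obtain ⟨a, ha, b, hb, rfl⟩ := (mem_gen_gluing n).1 hn
    intro he
    push_cast at he
    obtain ⟨m, hm⟩ : (k₂ : ℤ) ∣ f₁ - a := by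
      exact hco.symm.dvd_of_dvd_mul_left ⟨b - f₂ - k₁, by linarith⟩
    -- With `f₁ = a + k₂ m`, either `m ≥ 0` puts `f₁` in `⟨A⟩`, or `f₂ = b + (-m - 1) k₁` lies in
    -- `⟨B⟩`.
    rcases le_or_gt 0 m with h | h
    · lift m to ℕ using h
      refine hA.1 (a + m • k₂) (add_mem ha (nsmul_mem hk₂ m)) ?_
      push_cast [smul_eq_mul]
      linarith
    · obtain ⟨l, hl⟩ : ∃ l : ℕ, (l : ℤ) = -m - 1 := ⟨(-m - 1).toNat, by omega⟩
      refine hB.1 (b + l • k₁) (add_mem hb (nsmul_mem hk₁ l)) ?_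
      push_cast [smul_eq_mul]
      rw [hl]
      refine mul_left_cancel₀ h₂'.ne' ?_
      have : f₁ = a + k₂ * m := by linarith
      rw [this] at he
      linarith
  · obtain ⟨x, y, hxy⟩ := hco
    have hlow := Int.emod_nonneg (z * x - f₁ - 1) h₂'.ne'
    have hupp := Int.emod_lt_of_pos (z * x - f₁ - 1) h₂'
    have hdiv := Int.mul_ediv_add_emod (z * x - f₁ - 1) k₂
    -- `u` is the solution of `k₁ u ≡ z` modulo `k₂` in the window `f₁ < u ≤ f₁ + k₂`. The lower
    -- bound puts `u` in `⟨A⟩`; the upper bound forces `v > f₂`.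
    set u := (z * x - f₁ - 1) % k₂ + f₁ + 1 with hu
    set t := (z * x - f₁ - 1) / k₂
    obtain ⟨v, hv⟩ : ∃ v, k₁ * u + k₂ * v = z := by
      refine ⟨z * y + k₁ * t, ?_⟩
      have : u = z * x - k₂ * t := by rw [hu]; linarith
      rw [this]
      linear_combination z * hxy
    have hv' : f₂ < v := by
      have h3 : (k₁ : ℤ) * u ≤ k₁ * (f₁ + k₂) := mul_le_mul_of_nonneg_left (by omega) h₁'.le
      refine lt_of_mul_lt_mul_left (a := (k₂ : ℤ)) ?_ h₂'.le
      linarith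
    obtain ⟨a, ha, hau⟩ : ∃ n ∈ gen A, (n : ℤ) = u := hA.exists_of_lt (by omega)
    obtain ⟨b, hb, rfl⟩ := hB.exists_of_lt hv'
    exact ⟨k₁ * a + k₂ * b, (mem_gen_gluing _).2 ⟨a, ha, b, hb, rfl⟩, by
      rw [← hau] at hv
      exact_mod_cast hv⟩

end Gluing

/-! ### The boundary cycle of the full simplex -/

section Simplex

variable {k σ : Type*} [Field k] [Fintype σ] [LinearOrder σ]

lemma cone_eq_zero (v : σ) {c : Finset σ → k} {i : ℕ} (hc : ∀ T, T.card ≠ i → c T = 0)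
    {T : Finset σ} (hT : T.card ≠ i + 1) : cone v c T = 0 := by
  rw [cone]
  split_ifs with hv
  · rw [hc, smul_zero]
    rw [Finset.card_erase_of_mem hv]
    have := Finset.card_pos.2 ⟨_, hv⟩
    omega
  · rfl

/-- The boundary of the full simplex on `σ`. -/
def simplexBoundary (k σ : Type*) [Field k] [Fintype σ] [LinearOrder σ] : Finset σ → k :=
  koszulD (fun _ => AddMonoidHom.id k) fun T => if T.card = Fintype.card σ then 1 else 0

lemma koszulD_simplexBoundary :
    koszulD (fun _ => AddMonoidHom.id k) (simplexBoundary k σ) = 0 :=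
  koszulD_koszulD _ (fun _ _ _ => rfl) _

lemma exists_of_simplexBoundary_ne_zero {T : Finset σ} (hT : simplexBoundary k σ T ≠ 0) :
    T.card + 1 = Fintype.card σ ∧
      ∃ s, ∀ g : σ → ℤ, g s + ∑ t ∈ T, g t = ∑ t, g t := by
  obtain ⟨s, hs, hs0⟩ := Finset.exists_ne_zero_of_sum_ne_zero hT
  rw [Finset.mem_compl] at hs
  have hcard : (insert s T).card = Fintype.card σ := by
    by_contra h
    simp [h] at hs0
  refine ⟨by rw [← hcard, Finset.card_insert_of_notMem hs], s, fun g => ?_⟩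
  rw [← Finset.sum_insert hs, (Finset.card_eq_iff_eq_univ _).1 hcard]

lemma simplexBoundary_ne_zero [Nonempty σ] : simplexBoundary k σ ≠ 0 := by
  intro h
  let v := Classical.arbitrary σ
  have h0 := congrFun h (Finset.univ.erase v)
  have hu : (Finset.univ.erase v)ᶜ = {v} := by
    ext; simp
  rw [simplexBoundary, koszulD_apply, hu, Finset.sum_singleton,
    Finset.insert_erase (Finset.mem_univ _), if_pos Finset.card_univ] at h0
  have h1 := congrArg (fun x => koszulSign v (Finset.univ.erase v) • x) h0
  simp only [smul_smul, koszulSign_mul_self, one_smul, Pi.zero_apply, smul_zero] at h1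
  simp at h1

end Simplex

/-! ### Strands of the Koszul complex of Laurent series -/

section LaurentStrand

variable {k σ : Type*} [Field k] [Fintype σ] [LinearOrder σ] {w : σ → ℕ} {i : ℕ} {j : ℤ}

/-- The Koszul chain of internal degree `j` with the given coefficients. -/
def laurentChain (w : σ → ℕ) (j : ℤ) (c : Finset σ → k) (T : Finset σ) : ℤ → k :=
  Pi.single (j - ∑ s ∈ T, (w s : ℤ)) (c T)

lemma laurentChain_injective : Function.Injective (laurentChain (k := k) w j) := fun c c' h => by
  ext T
  exact Pi.single_injective _ (congrFun h T)

lemma koszulD_laurentChain (c : Finset σ → k) :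
    koszulD (laurentOperators k w).x (laurentChain w j c) =
      laurentChain w j (koszulD (fun _ => AddMonoidHom.id k) c) := by
  ext T z
  rw [koszulD_apply, laurentChain, koszulD_apply, Finset.sum_apply, Pi.single_apply]
  have : ∀ s ∈ Tᶜ, (koszulSign s T • (laurentOperators k w).x s (laurentChain w j c (insert s T))) z
      = if z = j - ∑ s ∈ T, (w s : ℤ) then koszulSign s T • c (insert s T) else 0 := by
    intro s hs
    rw [Finset.mem_compl] at hs
    rw [Pi.smul_apply, laurentOperators_x, laurentChain, Pi.single_apply, Finset.sum_insert hs,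
      smul_ite, smul_zero]
    refine if_congr ?_ rfl rfl
    constructor <;> intro h <;> linarith
  rw [Finset.sum_congr rfl this]
  split_ifs
  · rfl
  · exact Finset.sum_const_zero

lemma exists_eq_laurentChain {f : Finset σ → ℤ → k}
    (hf : (laurentOperators k w).IsHomogeneous i j f) : ∃ c, f = laurentChain w j c :=
  ⟨fun T => f T (j - ∑ s ∈ T, (w s : ℤ)), by
    ext1 T
    exact (hf.comp_eq T).symm⟩

lemma isHomogeneous_laurentChain {c : Finset σ → k} (hc : ∀ T, T.card ≠ i → c T = 0) :
    (laurentOperators k w).IsHomogeneous i j (laurentChain w j c) := by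
  refine GradedOperators.isHomogeneous_of (fun T hT => ?_) fun T => ?_
  · rw [laurentChain, hc T hT, Pi.single_zero]
  · rw [laurentOperators_comp, laurentChain, Pi.single_eq_same]

end LaurentStrand

/-! ### Koszul homology of the semigroup ring -/

section KoszulHomology

variable {k : Type*} [Field k] {A : Finset ℕ} {f : ℤ}

lemma card_le_sum_weights (hA : ∀ a ∈ A, 0 < a) (T : Finset A) :
    (T.card : ℤ) ≤ ∑ s ∈ T, (weights A s : ℤ) := by
  rw [Finset.cast_card]
  exact Finset.sum_le_sum fun s _ => by exact_mod_cast hA s s.2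

lemma laurentChain_mem_range_embed {j : ℤ} {c : Finset A → k} {T : Finset A}
    (h : c T ≠ 0 → ∃ n ∈ gen A, (n : ℤ) = j - ∑ s ∈ T, (weights A s : ℤ)) :
    laurentChain (weights A) j c T ∈ (embed k A).range := by
  by_cases hc : c T = 0
  · rw [laurentChain, hc, Pi.single_zero]
    exact zero_mem _
  · obtain ⟨n, hn, hnj⟩ := h hc
    rw [laurentChain, ← hnj]
    exact single_mem_range_embed k A hn _

/-- For `#T = i + 1` the complement of `T` has weight at least `#A - i - 1`, so the hypothesis gives
`j - ∑ T > f`. The cone over a cycle therefore stays inside `k[A]`. -/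
lemma IsFrobenius.acyclic (hf : IsFrobenius A f) (hA : ∀ a ∈ A, 0 < a) [Nonempty A] {i : ℕ} {j : ℤ}
    (h : f + ∑ s, (weights A s : ℤ) - (A.card - 1) < j - i) :
    (laurentOperators k (weights A)).Acyclic (embed k A).range i j := by
  intro g hg _ hc
  obtain ⟨c, rfl⟩ := exists_eq_laurentChain hg
  rw [koszulD_laurentChain] at hc
  have hc' : koszulD (fun _ => AddMonoidHom.id k) c = 0 := by
    refine laurentChain_injective (w := weights A) (j := j) ?_
    rw [hc]
    ext1 T
    simp [laurentChain]
  have hc0 : ∀ T : Finset A, T.card ≠ i → c T = 0 := fun T hT => by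
    have := hg.eq_zero hT
    rwa [laurentChain, Pi.single_eq_zero_iff] at this
  refine ⟨laurentChain _ j (cone (Classical.arbitrary A) c),
    isHomogeneous_laurentChain fun _ hT => cone_eq_zero _ hc0 hT,
    fun T => laurentChain_mem_range_embed fun hT => hf.exists_of_lt ?_, ?_⟩
  · have hcard : T.card = i + 1 := by
      by_contra h'
      exact hT (cone_eq_zero _ hc0 h')
    have h1 := card_le_sum_weights hA Tᶜ
    have h2 := Finset.sum_add_sum_compl T fun s => (weights A s : ℤ)
    have h3 := Finset.card_add_card_compl T
    rw [Fintype.card_coe] at h3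
    omega
  · rw [koszulD_laurentChain]
    have := koszulD_cone (Classical.arbitrary A) c
    rw [hc'] at this
    congr 1
    convert this using 1
    ext T
    simp [cone]

/-- Omitting a vertex `s` leaves degree `f + w s > f`, so the boundary of the simplex has
coefficients in `k[A]`. A bounding chain lives on the full set, where the degree is `f ∉ ⟨A⟩`, and
so vanishes. -/
lemma IsFrobenius.not_acyclic (hf : IsFrobenius A f) (hA : ∀ a ∈ A, 0 < a) [Nonempty A] :
    ¬ (laurentOperators k (weights A)).Acyclic (embed k A).range (A.card - 1)
      (f + ∑ s, (weights A s : ℤ)) := by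
  intro h
  have hpos : 0 < A.card := by
    rw [← Fintype.card_coe]
    exact Fintype.card_pos
  obtain ⟨g, hg, hgr, hgc⟩ := h (laurentChain (weights A) _ (simplexBoundary k A))
    (isHomogeneous_laurentChain fun T hT => by
      by_contra h'
      have := (exists_of_simplexBoundary_ne_zero h').1
      rw [Fintype.card_coe] at this
      omega)
    (fun T => laurentChain_mem_range_embed fun hT => hf.exists_of_lt (by
      obtain ⟨-, s, hs⟩ := exists_of_simplexBoundary_ne_zero hT
      rw [← hs]
      have : 0 < weights A s := hA s s.2
      omega))
    (by
      rw [koszulD_laurentChain, koszulD_simplexBoundary]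
      ext1 T
      simp [laurentChain])
  obtain ⟨d, rfl⟩ := exists_eq_laurentChain hg
  have hd : d = 0 := by
    ext T
    by_contra hne
    have hT : T = Finset.univ := by
      rw [← Finset.card_eq_iff_eq_univ, Fintype.card_coe]
      by_contra h'
      have := hg.eq_zero (T := T) (by omega)
      rw [laurentChain, Pi.single_eq_zero_iff] at this
      exact hne this
    subst hT
    obtain ⟨y, hy⟩ := hgr Finset.univ
    obtain ⟨n, hn, hnf⟩ := exists_mem_gen_of_embed_ne_zero k A (y := y) (z := f) (by
      rw [hy, laurentChain, add_sub_cancel_right, Pi.single_eq_same]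
      exact hne)
    exact hf.1 n hn hnf
  rw [koszulD_laurentChain, hd, map_zero] at hgc
  exact simplexBoundary_ne_zero (laurentChain_injective hgc).symm

end KoszulHomology

/-! ### Regularity from the Frobenius number -/

section Regularity

variable (k : Type*) [Field k] {A : Finset ℕ} {f : ℤ}

lemma coeff_zero_eq_zero_of_mem_definingIdeal (hA : ∀ a ∈ A, 0 < a) {q : MvPolynomial A k}
    (hq : q ∈ definingIdeal k A) : coeff 0 q = 0 := by
  have h : (phi k A q).coeff 0 = 0 := by
    rw [(RingHom.mem_ker).1 hq, Polynomial.coeff_zero]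
  rw [coeff_phi] at h
  by_contra hne
  rw [Finset.sum_eq_single 0 (fun m _ hm => if_neg fun h' =>
    hm (eq_zero_of_weight_eq_zero (w := weights A) (fun s => hA s s.2) h'))
    (fun h' => by simpa using h')] at h
  rw [if_pos (map_zero _)] at h
  exact hne h

lemma nonempty_minimalGradedFreeResolution (hA : ∀ a ∈ A, 0 < a) [Nonempty A] :
    Nonempty (MinimalGradedFreeResolution (weights A) (SemigroupRing k A) (component k A)) := by
  let ε : (Unit →₀ MvPolynomial A k) →ₗ[MvPolynomial A k] SemigroupRing k A :=
    (Submodule.mkQ (definingIdeal k A)).comp (Finsupp.lapply ())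
  have hε : ∀ a, ε (Finsupp.single a 1) ∈ component k A ((fun _ : Unit => 0) a) := by
    intro a
    refine ⟨1, isWeightedHomogeneous_one k _, ?_⟩
    change _ = Submodule.Quotient.mk ((Finsupp.single () (1 : MvPolynomial A k)) ())
    rw [Finsupp.single_eq_same]
    rfl
  have hmem : ∀ y, ε y = 0 → y () ∈ definingIdeal k A := fun y hy =>
    (Submodule.Quotient.mk_eq_zero _).1 hy
  refine exists_minimalGradedFreeResolution (fun s : A => hA s s.2) (fun _ : Unit => 0) ε hε
    (fun y => ?_) (fun y hy j => ?_) fun y hy _ =>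
      coeff_zero_eq_zero_of_mem_definingIdeal k hA (hmem y hy)
  · obtain ⟨q, rfl⟩ := Submodule.mkQ_surjective _ y
    exact ⟨Finsupp.single () q, by simp [ε]⟩
  · have h1 := (isHom_embed k A hε).map_comp j y
    refine embed_injective k A ?_
    rw [map_zero]
    refine h1.trans ?_
    change (laurentOperators k (weights A)).comp j (embed k A (ε y)) = 0
    rw [hy, map_zero, map_zero]

/-- The regularity in terms of the Frobenius number. -/
theorem IsFrobenius.hasReg (hf : IsFrobenius A f) (hA : ∀ a ∈ A, 0 < a) (hne : A.Nonempty) :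
    HasReg k A (f + ∑ a ∈ A, (a : ℤ) - (A.card - 1)) := by
  have : Nonempty A := hne.to_subtype
  have hsum : ∑ a ∈ A, (a : ℤ) = ∑ s, (weights A s : ℤ) :=
    (Finset.sum_coe_sort A fun a => (a : ℤ)).symm
  have hcard := Finset.card_pos.2 hne
  refine ⟨nonempty_minimalGradedFreeResolution k hA, fun F => ?_⟩
  have hb := F.betti_ne_zero_iff_not_acyclic (embed_injective k A) (isHom_embed k A F.ε_homogeneous)
  rw [hsum]
  constructor
  -- The degree `f + ∑ a` is a natural number because `f ≥ -1` and `∑ a ≥ #A ≥ 1`.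
  · have h1 := hf.neg_one_le
    have h2 := card_le_sum_weights hA Finset.univ
    rw [Finset.card_univ, Fintype.card_coe] at h2
    obtain ⟨j, hj⟩ : ∃ j : ℕ, (j : ℤ) = f + ∑ s, (weights A s : ℤ) :=
      ⟨(f + ∑ s, (weights A s : ℤ)).toNat, by omega⟩
    refine ⟨A.card - 1, j, (hb _ _).2 ?_, by omega⟩
    rw [hj]
    exact hf.not_acyclic hA
  · rintro _ ⟨i, j, hij, rfl⟩
    by_contra h
    exact (hb i j).1 hij (hf.acyclic hA (not_le.1 h))

lemma IsMinGenNumerical.nonempty (hA : IsMinGenNumerical A) : A.Nonempty := by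
  rw [Finset.nonempty_iff_ne_empty]
  rintro rfl
  simpa using hA.gcd_eq_one

end Regularity

end NumSemigroup

/-! ### The regularity of a gluing -/

theorem corollary3p11 (k : Type*) [Field k] (A B C : Finset ℕ) (k₁ k₂ p q : ℕ)
    (hC : NumSemigroup.IsGluing C A B k₁ k₂) (hp : A.card = p) (hq : B.card = q) :
    ∃ regA regB regC : ℤ,
      NumSemigroup.HasReg k A regA ∧ NumSemigroup.HasReg k B regB ∧
      NumSemigroup.HasReg k C regC ∧
      regC = (k₁ : ℤ) * regA + (k₂ : ℤ) * regB + ((p : ℤ) - 1) * ((k₁ : ℤ) - 1)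
        + ((q : ℤ) - 1) * ((k₂ : ℤ) - 1) + (k₁ : ℤ) * (k₂ : ℤ) - 1 := by
  obtain ⟨f₁, hf₁⟩ := NumSemigroup.exists_isFrobenius hC.left.gcd_eq_one
  obtain ⟨f₂, hf₂⟩ := NumSemigroup.exists_isFrobenius hC.right.gcd_eq_one
  have hf := hf₁.gluing hC.pos₁ hC.pos₂ hC.coprime hC.mem₁ hC.mem₂ hf₂
  rw [← hC.union] at hf
  refine ⟨_, _, _, hf₁.hasReg k hC.left.pos hC.left.nonempty,
    hf₂.hasReg k hC.right.pos hC.right.nonempty, hf.hasReg k hC.glued.pos hC.glued.nonempty, ?_⟩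
  have hi₁ : Function.Injective fun a => k₁ * a := mul_right_injective₀ hC.pos₁.ne'
  have hi₂ : Function.Injective fun b => k₂ * b := mul_right_injective₀ hC.pos₂.ne'
  have hcard : C.card = p + q := by
    rw [hC.union, Finset.card_union_of_disjoint hC.disjoint, Finset.card_image_of_injective _ hi₁,
      Finset.card_image_of_injective _ hi₂, hp, hq]
  have hsum : ∑ c ∈ C, (c : ℤ) = k₁ * ∑ a ∈ A, (a : ℤ) + k₂ * ∑ b ∈ B, (b : ℤ) := by
    rw [hC.union, Finset.sum_union hC.disjoint, Finset.sum_image hi₁.injOn,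
      Finset.sum_image hi₂.injOn, Finset.mul_sum, Finset.mul_sum]
    push_cast
    rfl
  rw [hcard, hsum, hp, hq]
  push_cast
  ring
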